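/- Theorem 3.1. Let $(\mathsf M,\mathsf d)$ be a metric space whose metric is a measure definite kernel: there are a $\sigma$-finite measure space $(E,\mathcal E,\mu)$ and sets $A_x\in\mathcal E$ $(x\in\mathsf M)$ with $\mu(A_x)<\infty$ and $\mathsf d(x,y)=\mu(A_x\Delta A_y)$ for all $x,y\in\mathsf M$; assume that $\{(x,e):e\in A_x\}$ belongs to $\mathcal B(\mathsf M)\otimes\mathcal E$. Let $B_1\subset B_2\subset\cdots$ be sets in $\mathcal E$ with union $E$ and $\mu(B_n)<\infty$, and let $\mathbb M_p(E)$ be the space of measures $m$ on $(E,\mathcal E)$ with values in $\{0,1,2,\dots,\infty\}$ and $m(B_n)<\infty$ for all $n$, with the $\sigma$-algebra generated by the maps $m\mapsto m(A)$, $A\in\mathcal E$. Let $\lambda$ be a $\sigma$-finite Borel measure on $\mathsf M$, and let $\beta=2H\in(0,1]$, $\alpha\in(0,2]$, $\delta,\delta'>0$. For $r>0$ let $\mathcal S_{\beta,r}\ge 0$ be a random variable with $\mathbb E e^{-\theta \mathcal S_{\beta,r}}=e^{-r\theta^\beta}$ for $\theta>0$ (a $\beta$-stable subordinator at time $r$),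 and let $\mathbb P'_{\beta,r}$ be the law on $\mathbb M_p(E)$ of a Poisson point process with random intensity measure $\mathcal S_{\beta,r}\cdot\mu$, the family $(\mathbb P'_{\beta,r})_{r>0}$ being a probability kernel; $\mathbb E'_{\beta,r}$ is the corresponding expectation. Put $\widetilde p_{\beta,r}(x)=\mathbb P'_{\beta,r}(m(A_x)\text{ is odd})$, $$\Gamma^{(\beta)}_r(x,y)=\mathbb E'_{\beta,r}\big[(\mathbf 1_{\{m(A_x)\text{ is odd}\}}-\widetilde p_{\beta,r}(x))(\mathbf 1_{\{m(A_y)\text{ is odd}\}}-\widetilde p_{\beta,r}(y))\big],$$ $$\Gamma^{(\beta)}(x,y)=\log\frac{\mu(A_x)^\beta+\mu(A_y)^\beta}{\mathsf d(x,y)^\beta}.$$ Let $\mathcal F_{\delta,\delta',\beta}(\mathsf M)$ be the class of bounded Borel functions $f:\mathsf M\to\mathbb R$ with $\int|f|\,d\lambda<\infty$, $\int\mu(A_x)^\delta|f(x)|\,\lambda(dx)<\infty$, and, for some constant $C$ and all $r>0$, $\int\!\int e^{-\mathsf d(x,y)^\beta r}|f(x)f(y)|\,\lambda(dx)\lambda(dy)\le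 Cr^{-\delta'}$. (a) For every $r>0$, $\Gamma^{(\beta)}_r$ is nonnegative and is a positive definite kernel on $\mathsf M$ (all its finite Gram matrices are symmetric positive semidefinite). For all $x\ne y$, $$\Gamma^{(\beta)}(x,y)=4\int_0^\infty\Gamma^{(\beta)}_r(x,y)\,\frac{dr}{r},$$ where the integral converges; for $x=y$ with $\mu(A_x)>0$ both sides are $+\infty$. (b) Let $M_{\alpha,\beta}$ be a symmetric $\alpha$-stable random measure, on some probability space, with control measure $2r^{-1}\,dr\,d\mathbb P'_{\beta,r}$ on $(0,\infty)\times\mathbb M_p(E)$; that is, $M_{\alpha,\beta}$ is independently scattered and $\sigma$-additive almost surely, and $\mathbb E e^{i\theta M_{\alpha,\beta}(S)}=e^{-|\theta|^\alpha m_0(S)}$ for every $S$ with finite control measure $m_0(S)$. For every $f\in\mathcal F_{\delta,\delta',\beta}(\mathsf M)$ the function $(r,m)\mapsto\int_{\mathsf M}(\mathbf 1_{\{m(A_x)\text{ is odd}\}}-\widetilde p_{\beta,r}(x))f(x)\,\lambda(dx)$ is well defined and belongs to $L^\alpha$ of the control measure. Hence its stochastic integral $$G_{\alpha,\beta}(f)=\int_{(0,\infty)\times\mathbb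 M_p(E)}\int_{\mathsf M}\big(\mathbf 1_{\{m(A_x)\text{ is odd}\}}-\widetilde p_{\beta,r}(x)\big)f(x)\,\lambda(dx)\,M_{\alpha,\beta}(dr\,dm),$$ defined as the limit in probability of the integrals of simple functions converging to the integrand in $L^\alpha$, exists and is almost surely unique. The family $\{G_{\alpha,\beta}(f)\}_{f\in\mathcal F_{\delta,\delta',\beta}(\mathsf M)}$ is jointly symmetric $\alpha$-stable (every finite linear combination has characteristic function $\theta\mapsto e^{-c|\theta|^\alpha}$ for some $c\ge0$), and $$\mathbb E e^{iG_{\alpha,\beta}(f)}=\exp\Big(-2\int_0^\infty\mathbb E'_{\beta,r}\Big|\int_{\mathsf M}\big(\mathbf 1_{\{m(A_x)\text{ is odd}\}}-\widetilde p_{\beta,r}(x)\big)f(x)\,\lambda(dx)\Big|^\alpha\frac{dr}{r}\Big),$$ where the integral in the exponent is finite. (c) If $\alpha=2$, then $\{G_{2,\beta}(f)\}_{f\in\mathcal F_{\delta,\delta',\beta}(\mathsf M)}$ is a centered (jointly) Gaussian family, and for all $f,g\in\mathcal F_{\delta,\delta',\beta}(\mathsf M)$ $$\operatorname{Cov}(G_{2,\beta}(f),G_{2,\beta}(g))=\int_{\mathsf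 M}\int_{\mathsf M}f(x)g(y)\,\Gamma^{(\beta)}(x,y)\,\lambda(dx)\lambda(dy),$$ where the integrand is $\lambda\otimes\lambda$-integrable, $f(x)g(y)$ vanishes $\lambda\otimes\lambda$-almost everywhere on the diagonal $\{x=y\}$, and the integrand is taken to be $0$ on the diagonal. -/

import Mathlib

open MeasureTheory ProbabilityTheory Set Filter Topology
open scoped ENNReal NNReal

noncomputable section

namespace LogCorr

/-! ### Point measures -/

/-- A localizing sequence of the measure space `(E, μ)`: measurable sets of finite measure that
increase to `E`. On a locally compact second countable Hausdorff space with a Radon measure `μ`, an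
exhaustion by compact sets is one. -/
structure IsLocalizing {E : Type*} [MeasurableSpace E] (μ : Measure E) (B : ℕ → Set E) : Prop where
  measurableSet : ∀ n, MeasurableSet (B n)
  mono : Monotone B
  iUnion_eq : ⋃ n, B n = univ
  measure_lt_top : ∀ n, μ (B n) < ∞

/-- The space of locally finite point measures on `E`: measures with values in `{0, 1, 2, …, ∞}`
that are finite on every set of the localizing sequence `B`. With `B` an exhaustion of a locally
compact second countable Hausdorff space by compact sets, whose interiors cover the space, these are
the Radon point measures. -/
def PointMeasure {E : Type*} [MeasurableSpace E] (B : ℕ → Set E) : Type _ :=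
  {m : Measure E // (∀ S, MeasurableSet S → m S = ∞ ∨ ∃ k : ℕ, m S = k) ∧ ∀ n, m (B n) < ∞}

/-- The σ-algebra generated by the evaluations `m ↦ m S`, `S` measurable. -/
instance {E : Type*} [MeasurableSpace E] (B : ℕ → Set E) : MeasurableSpace (PointMeasure B) :=
  inferInstanceAs (MeasurableSpace {m : Measure E //
    (∀ S, MeasurableSet S → m S = ∞ ∨ ∃ k : ℕ, m S = k) ∧ ∀ n, m (B n) < ∞})

/-- `Q` is the law of a Poisson point process with intensity measure `ρ`: the number of points in a
set of finite intensity is Poisson distributed, and the numbers of points in disjoint sets are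
independent. -/
structure IsPoissonLaw {E : Type*} [MeasurableSpace E] {B : ℕ → Set E}
    (ρ : Measure E) (Q : Measure (PointMeasure B)) : Prop where
  isProbabilityMeasure : IsProbabilityMeasure Q
  count_law : ∀ S, MeasurableSet S → ρ S < ∞ →
    Q.map (fun m => m.1 S) = (poissonMeasure (ρ S).toNNReal).map (fun k : ℕ => (k : ℝ≥0∞))
  indep : ∀ (n : ℕ) (S : Fin n → Set E), (∀ i, MeasurableSet (S i)) → (∀ i, ρ (S i) < ∞) →
    Pairwise (fun i j => Disjoint (S i) (S j)) →
    iIndepFun (fun (i : Fin n) (m : PointMeasure B) => m.1 (S i)) Q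

/-- `ν` is the law of the `β`-stable subordinator at time `r`. -/
structure IsSubordinatorLaw (β r : ℝ) (ν : Measure ℝ≥0) : Prop where
  isProbabilityMeasure : IsProbabilityMeasure ν
  laplace : ∀ θ : ℝ, 0 < θ → ∫ s : ℝ≥0, Real.exp (-(θ * s)) ∂ν = Real.exp (-(r * θ ^ β))

/-- `Q` is the law of the Poisson point process with random intensity measure `S • μ`, where `S` is
the `β`-stable subordinator at time `r`: conditionally on `S = s`, the process is Poisson with
intensity `s • μ`. -/
def IsStablePoissonLaw {E : Type*} [MeasurableSpace E] {B : ℕ → Set E}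
    (μ : Measure E) (β r : ℝ) (Q : Measure (PointMeasure B)) : Prop :=
  ∃ (ν : Measure ℝ≥0) (κ : Kernel ℝ≥0 (PointMeasure B)),
    IsSubordinatorLaw β r ν ∧ (∀ s : ℝ≥0, IsPoissonLaw (s • μ) (κ s)) ∧ Q = ν.bind κ

/-! ### Symmetric stable variables, random measures and stochastic integrals -/

/-- The family `X` of random variables is (jointly) symmetric `α`-stable: every finite linear
combination has a characteristic function of the form `θ ↦ exp (-c |θ|^α)`. -/
def IsSymmStableFamily {Ω T : Type*} [MeasurableSpace Ω] (α : ℝ) (X : T → Ω → ℝ)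
    (Pr : Measure Ω) : Prop :=
  (∀ t, AEMeasurable (X t) Pr) ∧
  ∀ (I : Finset T) (a : T → ℝ), ∃ c : ℝ, 0 ≤ c ∧ ∀ θ : ℝ,
    ∫ ω, Complex.exp (Complex.I * ((θ * ∑ t ∈ I, a t * X t ω : ℝ) : ℂ)) ∂Pr
      = Complex.exp ((-(c * |θ| ^ α) : ℝ) : ℂ)

/-- `M` is a symmetric `α`-stable random measure with control measure `m`. Only the values of `M` on
measurable sets of finite control measure matter. -/
structure IsSymmStableRandomMeasure {Ω X : Type*} [MeasurableSpace Ω] [MeasurableSpace X] (α : ℝ)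
    (m : Measure X) (M : Set X → Ω → ℝ) (Pr : Measure Ω) : Prop where
  aemeasurable : ∀ S, MeasurableSet S → m S < ∞ → AEMeasurable (M S) Pr
  charFun_eq : ∀ S, MeasurableSet S → m S < ∞ → ∀ θ : ℝ,
    ∫ ω, Complex.exp (Complex.I * ((θ * M S ω : ℝ) : ℂ)) ∂Pr
      = Complex.exp ((-(|θ| ^ α * (m S).toReal) : ℝ) : ℂ)
  /-- independently scattered -/
  indep : ∀ (n : ℕ) (S : Fin n → Set X), (∀ i, MeasurableSet (S i)) → (∀ i, m (S i) < ∞) →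
    Pairwise (fun i j => Disjoint (S i) (S j)) → iIndepFun (fun i => M (S i)) Pr
  /-- σ-additive -/
  sigma_additive : ∀ S : ℕ → Set X, (∀ i, MeasurableSet (S i)) → m (⋃ i, S i) < ∞ →
    Pairwise (fun i j => Disjoint (S i) (S j)) →
    ∀ᵐ ω ∂Pr, Tendsto (fun n => ∑ i ∈ Finset.range n, M (S i) ω) atTop (𝓝 (M (⋃ i, S i) ω))

/-- The integral of a simple function against `M`. -/
def simpleIntegral {Ω X : Type*} [MeasurableSpace X] (M : Set X → Ω → ℝ) (φ : SimpleFunc X ℝ)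
    (ω : Ω) : ℝ :=
  ∑ c ∈ φ.range, c * M (φ ⁻¹' {c}) ω

/-- `I` is a version of the stochastic integral `∫ g dM`: the limit in probability of integrals of
simple functions that converge to `g` in `L^α` of the control measure. -/
def IsStochasticIntegral {Ω X : Type*} [MeasurableSpace Ω] [MeasurableSpace X] (α : ℝ)
    (m : Measure X) (M : Set X → Ω → ℝ) (Pr : Measure Ω) (g : X → ℝ) (I : Ω → ℝ) : Prop :=
  AEMeasurable I Pr ∧ ∃ φ : ℕ → SimpleFunc X ℝ, (∀ n, (φ n).FinMeasSupp m) ∧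
    Tendsto (fun n => eLpNorm (fun p => φ n p - g p) (ENNReal.ofReal α) m) atTop (𝓝 0) ∧
    TendstoInMeasure Pr (fun n => simpleIntegral M (φ n)) atTop I

open Classical in
/-- The stochastic integral `∫ g dM` (a version of it, or zero if it does not exist). -/
def stochasticIntegral {Ω X : Type*} [MeasurableSpace Ω] [MeasurableSpace X] (α : ℝ)
    (m : Measure X) (M : Set X → Ω → ℝ) (Pr : Measure Ω) (g : X → ℝ) : Ω → ℝ :=
  if h : ∃ I, IsStochasticIntegral α m M Pr g I then h.choose else 0

/-! ### The generalized process -/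

/-- The event that `m (A_x)` is odd (in particular finite). -/
def oddEvent {E 𝕏 : Type*} [MeasurableSpace E] {B : ℕ → Set E} (A : 𝕏 → Set E) (x : 𝕏) :
    Set (PointMeasure B) :=
  {m | ∃ k : ℕ, Odd k ∧ m.1 (A x) = k}

/-- The centred variable `1{m (A_x) is odd} - P'_r (m (A_x) is odd)`. -/
def centredOdd {E 𝕏 : Type*} [MeasurableSpace E] {B : ℕ → Set E} (A : 𝕏 → Set E)
    (P' : Kernel ℝ (PointMeasure B)) (r : ℝ) (m : PointMeasure B) (x : 𝕏) : ℝ :=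
  (oddEvent A x).indicator (fun _ => 1) m - (P' r).real (oddEvent A x)

/-- The integrand `(r, m) ↦ ∫ (1{m (A_x) is odd} - P'_r (m (A_x) is odd)) f x λ(dx)`. -/
def integrand {E 𝕏 : Type*} [MeasurableSpace E] [MeasurableSpace 𝕏] {B : ℕ → Set E}
    (A : 𝕏 → Set E) (lam : Measure 𝕏) (P' : Kernel ℝ (PointMeasure B)) (f : 𝕏 → ℝ)
    (p : ℝ × PointMeasure B) : ℝ :=
  ∫ x, centredOdd A P' p.1 p.2 x * f x ∂lam

/-- The control measure `2 r⁻¹ dr dP'_r` on `(0, ∞) × PointMeasure B`, as a measure on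
`ℝ × PointMeasure B` that does not charge `r ≤ 0`. -/
def controlMeasure {E : Type*} [MeasurableSpace E] {B : ℕ → Set E}
    (P' : Kernel ℝ (PointMeasure B)) : Measure (ℝ × PointMeasure B) :=
  Measure.compProd
    ((volume.restrict (Ioi (0 : ℝ))).withDensity (fun r => ENNReal.ofReal (2 / r))) P'

/-- `G_{α,β}(f)`; the parameter `β` enters through `P'`. -/
def G {E 𝕏 Ω : Type*} [MeasurableSpace E] [MeasurableSpace 𝕏] [MeasurableSpace Ω] {B : ℕ → Set E}
    (A : 𝕏 → Set E) (lam : Measure 𝕏) (P' : Kernel ℝ (PointMeasure B)) (α : ℝ)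
    (M : Set (ℝ × PointMeasure B) → Ω → ℝ) (Pr : Measure Ω) (f : 𝕏 → ℝ) : Ω → ℝ :=
  stochasticIntegral α (controlMeasure P') M Pr (integrand A lam P' f)

/-- The class of test functions `F_{δ,δ',β}`. -/
structure IsTestFunction {E 𝕏 : Type*} [MeasurableSpace E] [MetricSpace 𝕏] [MeasurableSpace 𝕏]
    (μ : Measure E) (A : 𝕏 → Set E) (lam : Measure 𝕏) (δ δ' β : ℝ) (f : 𝕏 → ℝ) : Prop where
  measurable : Measurable f
  bounded : ∃ C : ℝ, ∀ x, |f x| ≤ C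
  integrable : Integrable f lam
  integrable_weight : Integrable (fun x => (μ.real (A x)) ^ δ * |f x|) lam
  decay : ∃ C : ℝ, ∀ r : ℝ, 0 < r →
    ∫ x, ∫ y, Real.exp (-((dist x y) ^ β * r)) * |f x * f y| ∂lam ∂lam ≤ C * r ^ (-δ')

/-- The kernel `Γ_r`: the covariance of the two parity indicators under `P'_r`. -/
def gammaR {E 𝕏 : Type*} [MeasurableSpace E] {B : ℕ → Set E} (A : 𝕏 → Set E)
    (P' : Kernel ℝ (PointMeasure B)) (r : ℝ) (x y : 𝕏) : ℝ :=
  ∫ m, centredOdd A P' r m x * centredOdd A P' r m y ∂(P' r)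

/-- The kernel `Γ^β(x, y) = log ((μ(A_x)^β + μ(A_y)^β) / d(x, y)^β)`, meant for `x ≠ y`. -/
def Gam {E 𝕏 : Type*} [MeasurableSpace E] [MetricSpace 𝕏] (μ : Measure E) (A : 𝕏 → Set E)
    (β : ℝ) (x y : 𝕏) : ℝ :=
  Real.log (((μ.real (A x)) ^ β + (μ.real (A y)) ^ β) / (dist x y) ^ β)

end LogCorr

end

/-! Everything rests on the sign (-1)^{m(S)}. Points of S ∩ T are counted twice, so the signs of S
and T multiply to the sign of S Δ T (`paritySign_mul`). A Poisson variable of mean ρ has mean sign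
e^{-2ρ}; averaging over the subordinator turns this into its Laplace transform at 2μ(S), which is
e^{-r(2μ(S))^β}. The covariance of two parity indicators is therefore a quarter of e^{-r(2d(x,y))^β}
- e^{-r((2μ(A_x))^β + (2μ(A_y))^β)} (`gammaR_eq`). It is positive semidefinite as a covariance, and
nonnegative because μ(A_x Δ A_y) ≤ μ(A_x) + μ(A_y) and t ↦ t^β is subadditive for β ≤ 1. Integrated
against dr/r it is a Frullani integral, which produces the logarithm; on the diagonal the first
exponential is 1 and the integral diverges at infinity.

By Fubini, the second moment of the integrand under P'_r is the double integral of f(x) f(y)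
Γ_r(x,y). It is O(r^ε) for some ε > 0, by the weight μ(A_x)^δ, and O(r^{-δ'}), by the decay
hypothesis. Jensen's inequality carries both bounds over to every exponent α ≤ 2, so the integrand
lies in L^α of the control measure (`memLp_integrand`).

The stochastic integral is built for an arbitrary symmetric stable random measure. By independence
over level sets, the integral of a simple function φ has characteristic function exp(-|θ|^α ∫|φ|^α).
This controls its tails, so the integrals of a rapidly converging sequence of simple functions
converge almost surely by Borel–Cantelli (`exists_isStochasticIntegral`). The characteristic
function passes to the limit, linearity gives joint stability, and an integral of 0 has scale 0,
whence uniqueness.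

For α = 2 the integral of g is normal with variance 2∫g². Polarization gives the covariance, and
Fubini with the Frullani formula turns it into the integral of f(x) g(y) Γ(x,y). The diagonal is
negligible: let r → ∞ in the decay hypothesis. -/

noncomputable section

namespace LogCorr

/-! ### Point measures as an s-finite kernel -/

section PointMeasures

variable {E : Type*} [MeasurableSpace E] {B : ℕ → Set E}

lemma PointMeasure.measurable_val :
    Measurable (fun m : PointMeasure B => (m.1 : Measure E)) :=
  measurable_subtype_coe (p := fun m : Measure E =>
    (∀ S, MeasurableSet S → m S = ∞ ∨ ∃ k : ℕ, m S = k) ∧ ∀ n, m (B n) < ∞)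

lemma PointMeasure.measurable_apply {S : Set E} (hS : MeasurableSet S) :
    Measurable (fun m : PointMeasure B => m.1 S) :=
  (Measure.measurable_coe hS).comp PointMeasure.measurable_val

/-- The identity, as a kernel from point measures to points. -/
def PointMeasure.kernel (B : ℕ → Set E) : Kernel (PointMeasure B) E where
  toFun m := m.1
  measurable' := PointMeasure.measurable_val

open Classical in
lemma PointMeasure.isSFiniteKernel_kernel (hB : ∀ n, MeasurableSet (B n))
    (hU : ⋃ n, B n = univ) : IsSFiniteKernel (PointMeasure.kernel B) := by
  have hD : ∀ n, MeasurableSet (disjointed B n) := fun n => MeasurableSet.disjointed hB n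
  have hDfin : ∀ (m : PointMeasure B) n, m.1 (disjointed B n) < ∞ := fun m n =>
    (measure_mono (disjointed_subset B n)).trans_lt (m.2.2 n)
  have hT : ∀ p : ℕ × ℕ, MeasurableSet {m : PointMeasure B | m.1 (disjointed B p.1) = p.2} :=
    fun p => PointMeasure.measurable_apply (hD p.1) (measurableSet_singleton _)
  -- m(D_n), with D_n the n-th disjointed set, is finite but not bounded uniformly in m. Cutting
  -- further by the event m(D_n) = k makes each piece a kernel of mass at most k.
  let κ : ℕ × ℕ → Kernel (PointMeasure B) E := fun p =>
    Kernel.piecewise (hT p) ((PointMeasure.kernel B).restrict (hD p.1)) 0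
  have hκ : ∀ p, IsFiniteKernel (κ p) := by
    intro p
    refine ⟨⟨p.2, ENNReal.natCast_lt_top _, fun m => ?_⟩⟩
    simp only [κ, Kernel.piecewise_apply]
    split_ifs with h
    · rw [Kernel.restrict_apply, Measure.restrict_apply_univ]
      exact (show m.1 (disjointed B p.1) = p.2 from h).le
    · simp
  have hsum : PointMeasure.kernel B = Kernel.sum κ := by
    ext m S hS
    rw [Kernel.sum_apply' _ _ hS, ENNReal.tsum_prod (f := fun n k => κ (n, k) m S)]
    have h1 : ∀ n, ∑' k, κ (n, k) m S = m.1 (S ∩ disjointed B n) := by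
      intro n
      obtain ⟨k, hk⟩ := (m.2.1 _ (hD n)).resolve_left (hDfin m n).ne
      rw [tsum_eq_single k]
      · simp only [κ, Kernel.piecewise_apply]
        rw [if_pos (by exact hk), Kernel.restrict_apply, Measure.restrict_apply hS]
        rfl
      · intro j hj
        simp only [κ, Kernel.piecewise_apply]
        rw [if_neg]
        · simp
        · intro h
          have h' : m.1 (disjointed B n) = j := h
          rw [hk] at h'
          exact hj (by exact_mod_cast h'.symm)
    simp_rw [h1]
    rw [← measure_iUnion]
    · rw [← inter_iUnion, iUnion_disjointed, hU, inter_univ]; rfl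
    · intro i j hij
      exact ((disjoint_disjointed B hij).mono inter_subset_right inter_subset_right)
    · exact fun n => hS.inter (hD n)
  rw [hsum]
  infer_instance

end PointMeasures

/-! ### Parity of counts and joint measurability -/

/-- The odd natural numbers, as a set of extended nonnegative reals. -/
def oddValues : Set ℝ≥0∞ := {t | ∃ k : ℕ, Odd k ∧ t = k}

/-- `(-1)^t` if `t` is a natural number. -/
def paritySign (t : ℝ≥0∞) : ℝ := 1 - 2 * oddValues.indicator (fun _ => (1 : ℝ)) t

lemma measurableSet_oddValues : MeasurableSet oddValues := by
  have : oddValues = ⋃ k ∈ {k : ℕ | Odd k}, {(k : ℝ≥0∞)} := by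
    ext t; simp [oddValues]
  rw [this]
  exact MeasurableSet.biUnion (to_countable _) fun k _ => measurableSet_singleton _

lemma measurable_paritySign : Measurable paritySign :=
  measurable_const.sub ((measurable_const.indicator measurableSet_oddValues).const_mul 2)

lemma paritySign_natCast (k : ℕ) : paritySign k = (-1) ^ k := by
  unfold paritySign
  rcases Nat.even_or_odd k with h | h
  · rw [indicator_of_notMem, h.neg_one_pow]
    · norm_num
    · rintro ⟨j, hj, hkj⟩
      have : k = j := by exact_mod_cast hkj
      subst this
      exact (Nat.not_even_iff_odd.2 hj) h
  · rw [indicator_of_mem (show (k : ℝ≥0∞) ∈ oddValues from ⟨k, h, rfl⟩), h.neg_one_pow]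
    norm_num

lemma abs_paritySign (t : ℝ≥0∞) : |paritySign t| = 1 := by
  unfold paritySign
  by_cases h : t ∈ oddValues
  · rw [indicator_of_mem h]; norm_num
  · rw [indicator_of_notMem h]; norm_num

section Parity

variable {E 𝕏 : Type*} [MeasurableSpace E] {B : ℕ → Set E}

lemma indicator_oddEvent (A : 𝕏 → Set E) (x : 𝕏) (m : PointMeasure B) :
    (oddEvent A x).indicator (fun _ => (1 : ℝ)) m = (1 - paritySign (m.1 (A x))) / 2 := by
  have : (oddEvent A x).indicator (fun _ => (1 : ℝ)) m
      = oddValues.indicator (fun _ => (1 : ℝ)) (m.1 (A x)) := by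
    simp only [indicator]; rfl
  rw [this, paritySign]; ring

lemma measurableSet_oddEvent {A : 𝕏 → Set E} {x : 𝕏} (hA : MeasurableSet (A x)) :
    MeasurableSet (oddEvent (B := B) A x) :=
  PointMeasure.measurable_apply hA measurableSet_oddValues

/-- S-finiteness of the identity kernel makes the masses of measurable sections jointly measurable.
Measurability in m for fixed x would not suffice for Fubini over x. -/
lemma measurable_apply_section [MeasurableSpace 𝕏] {μ : Measure E} (hB : IsLocalizing μ B)
    {A : 𝕏 → Set E} (hA : MeasurableSet {p : 𝕏 × E | p.2 ∈ A p.1}) :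
    Measurable (fun p : PointMeasure B × 𝕏 => p.1.1 (A p.2)) := by
  have := PointMeasure.isSFiniteKernel_kernel hB.measurableSet hB.iUnion_eq
  have ht : MeasurableSet {q : (PointMeasure B × 𝕏) × E | q.2 ∈ A q.1.2} :=
    hA.preimage (f := fun q : (PointMeasure B × 𝕏) × E => (q.1.2, q.2)) (by fun_prop)
  exact Kernel.measurable_kernel_prodMk_left
    (κ := Kernel.prodMkRight 𝕏 (PointMeasure.kernel B)) ht

lemma measurable_centredOdd [MeasurableSpace 𝕏] {μ : Measure E} (hB : IsLocalizing μ B)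
    {A : 𝕏 → Set E} (hA : MeasurableSet {p : 𝕏 × E | p.2 ∈ A p.1})
    (P' : Kernel ℝ (PointMeasure B)) [IsMarkovKernel P'] :
    Measurable (fun q : (ℝ × PointMeasure B) × 𝕏 => centredOdd A P' q.1.1 q.1.2 q.2) := by
  have hodd : MeasurableSet {p : PointMeasure B × 𝕏 | p.1 ∈ oddEvent A p.2} :=
    measurable_apply_section hB hA measurableSet_oddValues
  unfold centredOdd
  refine Measurable.sub ?_ ?_
  · have : (fun q : (ℝ × PointMeasure B) × 𝕏 => (oddEvent A q.2).indicator (fun _ => (1 : ℝ)) q.1.2)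
        = {p : PointMeasure B × 𝕏 | p.1 ∈ oddEvent A p.2}.indicator (fun _ => (1 : ℝ))
          ∘ (fun q => (q.1.2, q.2)) := by
      ext q; simp [indicator]
    rw [this]
    exact (measurable_const.indicator hodd).comp (by fun_prop)
  · have h := Kernel.measurable_kernel_prodMk_left (κ := Kernel.prodMkRight 𝕏 P')
      (t := {q : (ℝ × 𝕏) × PointMeasure B | q.2 ∈ oddEvent A q.1.2})
      (hodd.preimage (f := fun q : (ℝ × 𝕏) × PointMeasure B => (q.2, q.1.2)) (by fun_prop))
    exact h.ennreal_toReal.comp (g := fun p : ℝ × 𝕏 => _)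
      (f := fun q : (ℝ × PointMeasure B) × 𝕏 => (q.1.1, q.2)) (by fun_prop)

lemma abs_centredOdd_le (A : 𝕏 → Set E) (P' : Kernel ℝ (PointMeasure B)) [IsMarkovKernel P']
    (r : ℝ) (m : PointMeasure B) (x : 𝕏) : |centredOdd A P' r m x| ≤ 1 := by
  unfold centredOdd
  have h1 : (P' r).real (oddEvent A x) ≤ 1 := measureReal_le_one
  have h2 : 0 ≤ (P' r).real (oddEvent A x) := measureReal_nonneg
  have h3 : 0 ≤ (oddEvent A x).indicator (fun _ => (1 : ℝ)) m :=
    indicator_nonneg (fun _ _ => zero_le_one) _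
  have h4 : (oddEvent A x).indicator (fun _ => (1 : ℝ)) m ≤ 1 :=
    indicator_le_self' (fun _ _ => zero_le_one) _
  rw [abs_le]; constructor <;> linarith

end Parity

/-! ### Mean and multiplicativity of the parity sign -/

section ParityLaw

variable {E : Type*} [MeasurableSpace E] {B : ℕ → Set E}

lemma integrable_paritySign (Q : Measure (PointMeasure B)) [IsFiniteMeasure Q] {S : Set E}
    (hS : MeasurableSet S) : Integrable (fun m => paritySign (m.1 S)) Q :=
  Integrable.of_bound
    (measurable_paritySign.comp (PointMeasure.measurable_apply hS)).aestronglyMeasurable 1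
    (ae_of_all _ fun _ => (abs_paritySign _).le)

/-- Inserting (-1)^k into the Poisson weights leaves e^{-ρ} times the exponential series at -ρ. -/
lemma IsPoissonLaw.integral_paritySign {ρ : Measure E} {Q : Measure (PointMeasure B)}
    (hQ : IsPoissonLaw ρ Q) {S : Set E} (hS : MeasurableSet S) (hfin : ρ S < ∞) :
    ∫ m, paritySign (m.1 S) ∂Q = Real.exp (-(2 * ρ.real S)) := by
  have h1 : ∫ m, paritySign (m.1 S) ∂Q = ∫ t, paritySign t ∂(Q.map (fun m => m.1 S)) :=
    (integral_map (PointMeasure.measurable_apply hS).aemeasurable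
      measurable_paritySign.aestronglyMeasurable).symm
  rw [h1, hQ.count_law S hS hfin,
    integral_map .of_discrete measurable_paritySign.aestronglyMeasurable, integral_poissonMeasure]
  simp_rw [paritySign_natCast]
  set r : ℝ := ((ρ S).toNNReal : ℝ)
  have hr : ρ.real S = r := rfl
  have h2 : ∀ n : ℕ, (Real.exp (-r) * r ^ n / (n.factorial : ℝ)) • ((-1 : ℝ) ^ n)
      = Real.exp (-r) * ((-r) ^ n / (n.factorial : ℝ)) := by
    intro n
    rw [smul_eq_mul, neg_pow r]
    ring
  simp_rw [h2]
  rw [tsum_mul_left, hr]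
  have h3 := (NormedSpace.expSeries_div_hasSum_exp (𝔸 := ℝ) (-r)).tsum_eq
  rw [h3, ← Real.exp_eq_exp_ℝ, ← Real.exp_add]
  congr 1; ring

lemma IsPoissonLaw.ae_lt_top {ρ : Measure E} {Q : Measure (PointMeasure B)}
    (hQ : IsPoissonLaw ρ Q) {S : Set E} (hS : MeasurableSet S) (hfin : ρ S < ∞) :
    ∀ᵐ m ∂Q, m.1 S < ∞ := by
  have h : ∀ᵐ t ∂(Q.map (fun m => m.1 S)), t < ∞ := by
    rw [hQ.count_law S hS hfin, ae_map_iff .of_discrete measurableSet_Iio]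
    exact ae_of_all _ fun k => ENNReal.natCast_lt_top k
  rwa [ae_map_iff (PointMeasure.measurable_apply hS).aemeasurable measurableSet_Iio] at h

/-- Points of S ∩ T enter both counts, so their sign is squared and disappears. Finiteness is
essential: the sign of ∞ is 1 by convention, which is not multiplicative. -/
lemma paritySign_mul {m : PointMeasure B} {S T : Set E} (hS : MeasurableSet S)
    (hT : MeasurableSet T) (hSf : m.1 S < ∞) (hTf : m.1 T < ∞) :
    paritySign (m.1 S) * paritySign (m.1 T) = paritySign (m.1 (symmDiff S T)) := by
  have hfin : ∀ U, MeasurableSet U → m.1 U < ∞ → ∃ k : ℕ, m.1 U = k := fun U hU h =>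
    (m.2.1 U hU).resolve_left h.ne
  obtain ⟨a, ha⟩ := hfin (S \ T) (hS.diff hT) ((measure_mono sdiff_subset).trans_lt hSf)
  obtain ⟨b, hb⟩ := hfin (T \ S) (hT.diff hS) ((measure_mono sdiff_subset).trans_lt hTf)
  obtain ⟨c, hc⟩ := hfin (S ∩ T) (hS.inter hT) ((measure_mono inter_subset_left).trans_lt hSf)
  have h1 : m.1 S = ((c + a : ℕ) : ℝ≥0∞) := by
    rw [← measure_inter_add_sdiff S hT, ha, hc]; push_cast; rfl
  have h2 : m.1 T = ((c + b : ℕ) : ℝ≥0∞) := by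
    rw [← measure_inter_add_sdiff T hS, inter_comm, hb, hc]; push_cast; rfl
  have h3 : m.1 (symmDiff S T) = ((a + b : ℕ) : ℝ≥0∞) := by
    rw [Set.symmDiff_def, measure_union disjoint_sdiff_sdiff (hT.diff hS), ha, hb]
    push_cast; rfl
  rw [h1, h2, h3, paritySign_natCast, paritySign_natCast, paritySign_natCast, pow_add, pow_add,
    pow_add]
  have : ((-1 : ℝ) ^ c) * (-1) ^ c = 1 := by rw [← mul_pow]; norm_num
  linear_combination ((-1 : ℝ) ^ a * (-1) ^ b) * this

variable {μ : Measure E} {β r : ℝ} {Q : Measure (PointMeasure B)}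

/-- Conditionally on the intensity s the mean sign is e^{-2sμ(S)}; averaging over s gives the
Laplace transform of the subordinator at 2μ(S). -/
lemma IsStablePoissonLaw.integral_paritySign (hQ : IsStablePoissonLaw μ β r Q) (hβ : 0 < β)
    {S : Set E} (hS : MeasurableSet S) (hfin : μ S < ∞) :
    ∫ m, paritySign (m.1 S) ∂Q = Real.exp (-(r * (2 * μ.real S) ^ β)) := by
  obtain ⟨ν, κ, hν, hκ, rfl⟩ := hQ
  have := hν.isProbabilityMeasure
  have : IsMarkovKernel κ := ⟨fun s => (hκ s).isProbabilityMeasure⟩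
  have h1 := Kernel.integral_comp (κ := Kernel.const Unit ν) (η := κ) (a := ())
    (f := fun m : PointMeasure B => paritySign (m.1 S)) (integrable_paritySign _ hS)
  rw [Kernel.comp_apply, Kernel.const_apply] at h1
  rw [h1]
  have h2 : ∀ s : ℝ≥0, ∫ m, paritySign (m.1 S) ∂(κ s) = Real.exp (-((2 * μ.real S) * s)) := by
    intro s
    have hs : (s • μ) S < ∞ := by
      rw [Measure.smul_apply]
      exact ENNReal.mul_lt_top ENNReal.coe_lt_top hfin
    rw [(hκ s).integral_paritySign hS hs, measureReal_nnreal_smul_apply]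
    congr 2; ring
  simp_rw [h2]
  -- The Laplace formula is only given for positive arguments; a null set S is handled by 0^β = 0.
  rcases (measureReal_nonneg (μ := μ) (s := S)).eq_or_lt with h0 | h0
  · simp [← h0, Real.zero_rpow hβ.ne']
  · exact hν.laplace _ (by positivity)

lemma IsStablePoissonLaw.ae_lt_top (hQ : IsStablePoissonLaw μ β r Q) {S : Set E}
    (hS : MeasurableSet S) (hfin : μ S < ∞) : ∀ᵐ m ∂Q, m.1 S < ∞ := by
  obtain ⟨ν, κ, hν, hκ, rfl⟩ := hQ
  refine Measure.ae_comp_of_ae_ae (measurableSet_lt (PointMeasure.measurable_apply hS)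
    measurable_const) (ae_of_all _ fun s => (hκ s).ae_lt_top hS ?_)
  rw [Measure.smul_apply]
  exact ENNReal.mul_lt_top ENNReal.coe_lt_top hfin

end ParityLaw

/-! ### The covariance of two parity indicators -/

section Gamma

variable {E 𝕏 : Type*} [MeasurableSpace E] {B : ℕ → Set E} {μ : Measure E} {β r : ℝ}
  {A : 𝕏 → Set E} {P' : Kernel ℝ (PointMeasure B)} [IsMarkovKernel P']

lemma integrable_centredOdd (hA : ∀ x, MeasurableSet (A x)) (x : 𝕏) :
    Integrable (fun m => centredOdd A P' r m x) (P' r) :=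
  Integrable.of_bound ((measurable_const.indicator (measurableSet_oddEvent (hA x))).sub
    measurable_const).aestronglyMeasurable 1 (ae_of_all _ fun _ => abs_centredOdd_le _ _ _ _ _)

lemma integrable_centredOdd_mul (hA : ∀ x, MeasurableSet (A x)) (x y : 𝕏) :
    Integrable (fun m => centredOdd A P' r m x * centredOdd A P' r m y) (P' r) :=
  (integrable_centredOdd hA y).bdd_mul (integrable_centredOdd hA x).aestronglyMeasurable
    (ae_of_all _ fun _ => abs_centredOdd_le _ _ _ _ _)

lemma centredOdd_eq (hQ : IsStablePoissonLaw μ β r (P' r)) (hβ : 0 < β)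
    (hA : ∀ x, MeasurableSet (A x)) (hfin : ∀ x, μ (A x) < ∞) (m : PointMeasure B) (x : 𝕏) :
    centredOdd A P' r m x
      = (Real.exp (-(r * (2 * μ.real (A x)) ^ β)) - paritySign (m.1 (A x))) / 2 := by
  have h : (P' r).real (oddEvent A x) = (1 - Real.exp (-(r * (2 * μ.real (A x)) ^ β))) / 2 := by
    have h1 : (P' r).real (oddEvent A x)
        = ∫ m, (oddEvent (B := B) A x).indicator (fun _ => (1 : ℝ)) m ∂(P' r) := by
      have := integral_indicator_one (μ := P' r) (measurableSet_oddEvent (B := B) (hA x))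
      exact this.symm
    rw [h1]
    simp_rw [indicator_oddEvent]
    rw [integral_div, integral_sub (integrable_const _) (integrable_paritySign _ (hA x)),
      hQ.integral_paritySign hβ (hA x) (hfin x)]
    simp
  rw [centredOdd, h, indicator_oddEvent]
  ring

/-- Each centred indicator is half the mean sign minus the sign. In the product, the two signs
combine to the sign of the symmetric difference, whose mean is known; the mean of the remaining
terms is minus the product of the two means. -/
lemma gammaR_eq (hQ : IsStablePoissonLaw μ β r (P' r)) (hβ : 0 < β)
    (hA : ∀ x, MeasurableSet (A x)) (hfin : ∀ x, μ (A x) < ∞) (x y : 𝕏) :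
    gammaR A P' r x y = (Real.exp (-(r * (2 * μ.real (symmDiff (A x) (A y))) ^ β))
      - Real.exp (-(r * ((2 * μ.real (A x)) ^ β + (2 * μ.real (A y)) ^ β)))) / 4 := by
  have hD : MeasurableSet (symmDiff (A x) (A y)) := (hA x).symmDiff (hA y)
  have hDfin : μ (symmDiff (A x) (A y)) < ∞ :=
    (measure_mono symmDiff_subset_union).trans_lt (measure_union_lt_top (hfin x) (hfin y))
  set a := Real.exp (-(r * (2 * μ.real (A x)) ^ β)) with ha
  set b := Real.exp (-(r * (2 * μ.real (A y)) ^ β)) with hb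
  have hab : Real.exp (-(r * ((2 * μ.real (A x)) ^ β + (2 * μ.real (A y)) ^ β))) = a * b := by
    rw [ha, hb, ← Real.exp_add]; congr 1; ring
  have hae : ∀ᵐ m ∂(P' r), centredOdd A P' r m x * centredOdd A P' r m y
      = (a * b / 4 + paritySign (m.1 (symmDiff (A x) (A y))) / 4)
        - (a / 4 * paritySign (m.1 (A y)) + b / 4 * paritySign (m.1 (A x))) := by
    filter_upwards [hQ.ae_lt_top (hA x) (hfin x), hQ.ae_lt_top (hA y) (hfin y)] with m hx hy
    rw [centredOdd_eq hQ hβ hA hfin, centredOdd_eq hQ hβ hA hfin,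
      ← paritySign_mul (hA x) (hA y) hx hy]
    ring
  rw [gammaR, integral_congr_ae hae, integral_sub, integral_add, integral_add]
  · simp only [integral_const, probReal_univ, smul_eq_mul, integral_div, integral_const_mul]
    rw [hQ.integral_paritySign hβ hD hDfin, hQ.integral_paritySign hβ (hA x) (hfin x),
      hQ.integral_paritySign hβ (hA y) (hfin y), hab]
    ring
  · exact (integrable_paritySign _ (hA y)).const_mul _
  · exact (integrable_paritySign _ (hA x)).const_mul _
  · exact integrable_const _
  · exact (integrable_paritySign _ hD).div_const _
  · exact (integrable_const _).add ((integrable_paritySign _ hD).div_const _)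
  · exact ((integrable_paritySign _ (hA y)).const_mul _).add
      ((integrable_paritySign _ (hA x)).const_mul _)

/-- The quadratic form at v is the second moment of the v-combination of the centred indicators. -/
lemma posSemidef_gammaR (hA : ∀ x, MeasurableSet (A x)) (n : ℕ) (x : Fin n → 𝕏) :
    (Matrix.of fun i j => gammaR A P' r (x i) (x j)).PosSemidef := by
  refine Matrix.PosSemidef.of_dotProduct_mulVec_nonneg ?_ fun v => ?_
  · ext i j
    simp only [Matrix.conjTranspose_apply, Matrix.of_apply, star_trivial, gammaR]
    congr 1; ext m; ring
  · have h : star v ⬝ᵥ (Matrix.of fun i j => gammaR A P' r (x i) (x j)).mulVec v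
        = ∫ m, (∑ i, v i * centredOdd A P' r m (x i)) ^ 2 ∂(P' r) := by
      have : ∀ m, (∑ i, v i * centredOdd A P' r m (x i)) ^ 2
          = ∑ i, ∑ j, v i * v j * (centredOdd A P' r m (x i) * centredOdd A P' r m (x j)) := by
        intro m
        rw [sq, Finset.sum_mul_sum]
        refine Finset.sum_congr rfl fun i _ => Finset.sum_congr rfl fun j _ => by ring
      simp_rw [this]
      rw [integral_finsetSum _ fun i _ => integrable_finsetSum _ fun j _ =>
        (integrable_centredOdd_mul hA _ _).const_mul _]
      simp only [dotProduct, Matrix.mulVec, Matrix.of_apply, star_trivial, Finset.mul_sum]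
      refine Finset.sum_congr rfl fun i _ => ?_
      rw [integral_finsetSum _ fun j _ => (integrable_centredOdd_mul hA _ _).const_mul _]
      refine Finset.sum_congr rfl fun j _ => ?_
      rw [integral_const_mul, gammaR]
      ring
    rw [h]
    exact integral_nonneg fun m => sq_nonneg _

end Gamma

/-! ### Frullani's integral and elementary inequalities -/

lemma integrableOn_exp_sub_exp_div {p q : ℝ} (hp : 0 < p) (hpq : p ≤ q) :
    IntegrableOn (fun r => r⁻¹ • (Real.exp (-(p * r)) - Real.exp (-(q * r)))) (Ioi 0) := by
  have hint : IntegrableOn (fun r => (q - p) * Real.exp (-p * r)) (Ioi 0) :=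
    (exp_neg_integrableOn_Ioi 0 hp).const_mul _
  refine Integrable.mono' hint (by fun_prop) ?_
  filter_upwards [ae_restrict_mem measurableSet_Ioi] with r hr
  have hr : 0 < r := hr
  have h1 : Real.exp (-(q * r)) ≤ Real.exp (-(p * r)) :=
    Real.exp_le_exp.2 (neg_le_neg (mul_le_mul_of_nonneg_right hpq hr.le))
  rw [smul_eq_mul, Real.norm_of_nonneg (mul_nonneg (inv_nonneg.2 hr.le) (sub_nonneg.2 h1)),
    inv_mul_le_iff₀ hr]
  have h2 : Real.exp (-(q * r)) = Real.exp (-p * r) * Real.exp (-((q - p) * r)) := by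
    rw [← Real.exp_add]; congr 1; ring
  -- The bound 1 - e^{-u} ≤ u with u = (q - p)r absorbs the singular factor 1/r at the origin.
  have h3 : -((q - p) * r) + 1 ≤ Real.exp (-((q - p) * r)) := Real.add_one_le_exp _
  have h4 : Real.exp (-(p * r)) = Real.exp (-p * r) := by congr 1; ring
  rw [h2, h4]
  nlinarith [mul_le_mul_of_nonneg_left h3 (Real.exp_pos (-p * r)).le]

lemma integral_exp_sub_exp_div {p q : ℝ} (hp : 0 < p) (hpq : p ≤ q) :
    ∫ r in Ioi (0 : ℝ), r⁻¹ • (Real.exp (-(p * r)) - Real.exp (-(q * r))) = Real.log (q / p) := by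
  have hc : Continuous fun x : ℝ => Real.exp (-x) := by fun_prop
  have h := Frullani.integral_Ioi_eq (f := fun x : ℝ => Real.exp (-x)) (L := 1) (R := 0)
    (hc.locallyIntegrable.locallyIntegrableOn _) hp (hp.trans_le hpq)
    (((by simpa using hc.tendsto 0 : Tendsto _ _ _)).mono_left nhdsWithin_le_nhds)
    (Real.tendsto_exp_atBot.comp tendsto_neg_atTop_atBot)
    (integrableOn_exp_sub_exp_div hp hpq)
  simpa using h

lemma one_sub_exp_neg_le_rpow {t ε : ℝ} (ht : 0 ≤ t) (hε : 0 < ε) (hε1 : ε ≤ 1) :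
    1 - Real.exp (-t) ≤ t ^ ε := by
  rcases le_total t 1 with h | h
  · calc 1 - Real.exp (-t) ≤ t := by linarith [Real.add_one_le_exp (-t)]
      _ = t ^ (1 : ℝ) := (Real.rpow_one t).symm
      _ ≤ t ^ ε := Real.rpow_le_rpow_of_exponent_ge' ht h hε.le hε1
  · exact (by linarith [Real.exp_pos (-t)] : 1 - Real.exp (-t) ≤ 1).trans (Real.one_le_rpow h hε.le)

lemma rpow_le_one_add_rpow {t s u : ℝ} (ht : 0 ≤ t) (hs : 0 ≤ s) (hsu : s ≤ u) :
    t ^ s ≤ 1 + t ^ u := by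
  have hu := Real.rpow_nonneg ht u
  rcases le_total t 1 with h | h
  · linarith [Real.rpow_le_one ht h hs]
  · linarith [Real.rpow_le_rpow_of_exponent_le h hsu]

/-! ### Bounds on Γ_r and its integral against dr/r -/

section GammaBounds

variable {E 𝕏 : Type*} [MeasurableSpace E] {B : ℕ → Set E} {μ : Measure E} {β r : ℝ}
  {A : 𝕏 → Set E} {P' : Kernel ℝ (PointMeasure B)} [IsMarkovKernel P']

/-- Subadditivity of μ and of t ↦ t^β; this is where β ≤ 1 enters. It orders the two exponents in
Γ_r, as needed for nonnegativity and for the Frullani integral. -/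
lemma measureReal_symmDiff_rpow_le (hβ : 0 < β) (hβ1 : β ≤ 1) (hfin : ∀ x, μ (A x) < ∞)
    (x y : 𝕏) : (2 * μ.real (symmDiff (A x) (A y))) ^ β
      ≤ (2 * μ.real (A x)) ^ β + (2 * μ.real (A y)) ^ β := by
  have h : μ.real (symmDiff (A x) (A y)) ≤ μ.real (A x) + μ.real (A y) :=
    (measureReal_mono symmDiff_subset_union (measure_union_lt_top (hfin x) (hfin y)).ne).trans
      (measureReal_union_le _ _)
  have ha : 0 ≤ μ.real (A x) := measureReal_nonneg
  have hb : 0 ≤ μ.real (A y) := measureReal_nonneg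
  calc (2 * μ.real (symmDiff (A x) (A y))) ^ β ≤ (2 * μ.real (A x) + 2 * μ.real (A y)) ^ β :=
        Real.rpow_le_rpow (by positivity) (by linarith) hβ.le
    _ ≤ _ := Real.rpow_add_le_add_rpow (by positivity) (by positivity) hβ.le hβ1

lemma gammaR_nonneg (hQ : IsStablePoissonLaw μ β r (P' r)) (hr : 0 < r) (hβ : 0 < β) (hβ1 : β ≤ 1)
    (hA : ∀ x, MeasurableSet (A x)) (hfin : ∀ x, μ (A x) < ∞) (x y : 𝕏) :
    0 ≤ gammaR A P' r x y := by
  rw [gammaR_eq hQ hβ hA hfin]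
  have := Real.exp_le_exp.2 (neg_le_neg (mul_le_mul_of_nonneg_left
    (measureReal_symmDiff_rpow_le hβ hβ1 hfin x y) hr.le))
  linarith

lemma gammaR_le_exp (hQ : IsStablePoissonLaw μ β r (P' r)) (hβ : 0 < β)
    (hA : ∀ x, MeasurableSet (A x)) (hfin : ∀ x, μ (A x) < ∞) (x y : 𝕏) :
    gammaR A P' r x y ≤ Real.exp (-(μ.real (symmDiff (A x) (A y)) ^ β * (2 ^ β * r))) := by
  rw [gammaR_eq hQ hβ hA hfin, Real.mul_rpow (by norm_num) measureReal_nonneg]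
  have h1 := Real.exp_pos (-(r * ((2 * μ.real (A x)) ^ β + (2 * μ.real (A y)) ^ β)))
  have h2 : r * (2 ^ β * μ.real (symmDiff (A x) (A y)) ^ β)
    = μ.real (symmDiff (A x) (A y)) ^ β * (2 ^ β * r) := by ring
  rw [h2]
  have h3 := Real.exp_pos (-(μ.real (symmDiff (A x) (A y)) ^ β * (2 ^ β * r)))
  linarith

/-- Decay as r → 0: the first exponential is at most 1, and 1 - e^{-t} ≤ t^ε for the second.
Subadditivity of t ↦ t^ε separates x from y, and βε ≤ δ reduces the resulting powers to the weight
of the test functions. -/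
lemma gammaR_le_rpow (hQ : IsStablePoissonLaw μ β r (P' r)) (hr : 0 < r) (hβ : 0 < β)
    (hA : ∀ x, MeasurableSet (A x)) (hfin : ∀ x, μ (A x) < ∞) {δ ε : ℝ} (hε : 0 < ε)
    (hε1 : ε ≤ 1) (hεδ : β * ε ≤ δ) (x y : 𝕏) :
    gammaR A P' r x y
      ≤ r ^ ε * (2 ^ δ * ((1 + μ.real (A x) ^ δ) + (1 + μ.real (A y) ^ δ))) := by
  have hδ : 0 < δ := (mul_pos hβ hε).trans_le hεδ
  have hw : ∀ z, ((2 * μ.real (A z)) ^ β) ^ ε ≤ 2 ^ δ * (1 + μ.real (A z) ^ δ) := by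
    intro z
    have ha : 0 ≤ μ.real (A z) := measureReal_nonneg
    have h1 : (1 : ℝ) ≤ 2 ^ δ := Real.one_le_rpow (by norm_num) hδ.le
    rw [← Real.rpow_mul (by positivity)]
    have h2 := rpow_le_one_add_rpow (t := 2 * μ.real (A z)) (by positivity) (by positivity) hεδ
    rw [Real.mul_rpow (z := δ) (by norm_num) ha] at h2
    linarith
  have hx : 0 ≤ (2 * μ.real (A x)) ^ β := by positivity
  have hy : 0 ≤ (2 * μ.real (A y)) ^ β := by positivity
  have h1 := one_sub_exp_neg_le_rpow
    (mul_nonneg hr.le (add_nonneg hx hy)) hε hε1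
  have h2 : (r * ((2 * μ.real (A x)) ^ β + (2 * μ.real (A y)) ^ β)) ^ ε
      ≤ r ^ ε * (2 ^ δ * ((1 + μ.real (A x) ^ δ) + (1 + μ.real (A y) ^ δ))) := by
    rw [Real.mul_rpow hr.le (add_nonneg hx hy)]
    refine mul_le_mul_of_nonneg_left ?_ (by positivity)
    have := Real.rpow_add_le_add_rpow hx hy hε.le hε1
    linarith [hw x, hw y]
  rw [gammaR_eq hQ hβ hA hfin]
  have h3 : Real.exp (-(r * (2 * μ.real (symmDiff (A x) (A y))) ^ β)) ≤ 1 := by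
    rw [Real.exp_le_one_iff, neg_nonpos]
    have : 0 ≤ μ.real (symmDiff (A x) (A y)) := measureReal_nonneg
    positivity
  have h4 : 0 ≤ 1 - Real.exp (-(r * ((2 * μ.real (A x)) ^ β + (2 * μ.real (A y)) ^ β))) := by
    rw [sub_nonneg, Real.exp_le_one_iff, neg_nonpos]
    positivity
  linarith

/-- On the diagonal the first exponential is 1, so Γ_r(x,x) stays above a positive constant for r >
1, and dr/r diverges at infinity. -/
lemma lintegral_gammaR_self_div (hP' : ∀ r : ℝ, 0 < r → IsStablePoissonLaw μ β r (P' r))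
    (hβ : 0 < β) (hA : ∀ x, MeasurableSet (A x)) (hfin : ∀ x, μ (A x) < ∞) {x : 𝕏}
    (hx : μ (A x) ≠ 0) :
    ∫⁻ r in Ioi (0 : ℝ), ENNReal.ofReal (gammaR A P' r x x / r) = ∞ := by
  have ha : 0 < μ.real (A x) := ENNReal.toReal_pos hx (hfin x).ne
  set c := (2 * μ.real (A x)) ^ β with hc
  have hcpos : 0 < c := by positivity
  set k := (1 - Real.exp (-(2 * c))) / 4 with hk
  have hkpos : 0 < k := by
    have : Real.exp (-(2 * c)) < 1 := by rw [Real.exp_lt_one_iff]; linarith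
    rw [hk]; linarith
  by_contra hne
  have h1 : ∫⁻ r in Ioi (1 : ℝ), ENNReal.ofReal (k * r⁻¹) ≠ ∞ := by
    refine ne_top_of_le_ne_top hne ?_
    refine (setLIntegral_mono_ae' measurableSet_Ioi (ae_of_all _ fun r hr => ?_)).trans
      (lintegral_mono_set (Ioi_subset_Ioi zero_le_one))
    have hr : 1 < r := hr
    have hr0 : 0 < r := one_pos.trans hr
    refine ENNReal.ofReal_le_ofReal ?_
    rw [gammaR_eq (hP' r hr0) hβ hA hfin, div_eq_mul_inv _ r]
    refine mul_le_mul_of_nonneg_right ?_ (inv_nonneg.2 hr0.le)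
    rw [symmDiff_self, hk]
    have h2 : Real.exp (-(r * (c + c))) ≤ Real.exp (-(2 * c)) :=
      Real.exp_le_exp.2 (by nlinarith)
    have h3 : Real.exp (-(r * (2 * μ.real (⊥ : Set E)) ^ β)) = 1 := by
      simp [Real.zero_rpow hβ.ne']
    rw [h3]
    linarith
  have h2 : IntegrableOn (fun r : ℝ => k * r⁻¹) (Ioi 1) := by
    refine ⟨by fun_prop, ?_⟩
    rw [hasFiniteIntegral_iff_ofReal]
    · exact lt_top_iff_ne_top.2 h1
    · filter_upwards [ae_restrict_mem measurableSet_Ioi] with r hr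
      exact mul_nonneg hkpos.le (inv_nonneg.2 (one_pos.trans hr).le)
  refine not_integrableOn_Ioi_inv (a := 1) ?_
  have h3 := h2.const_mul k⁻¹
  refine h3.congr (ae_of_all _ fun r => ?_)
  simp only
  field_simp

variable [MetricSpace 𝕏]

lemma gammaR_div_eq (hQ : IsStablePoissonLaw μ β r (P' r)) (hβ : 0 < β)
    (hA : ∀ x, MeasurableSet (A x)) (hfin : ∀ x, μ (A x) < ∞)
    (hd : ∀ x y, dist x y = μ.real (symmDiff (A x) (A y))) (x y : 𝕏) :
    gammaR A P' r x y / r = 4⁻¹ * (r⁻¹ • (Real.exp (-((2 ^ β * dist x y ^ β) * r))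
      - Real.exp (-((2 ^ β * (μ.real (A x) ^ β + μ.real (A y) ^ β)) * r)))) := by
  rw [gammaR_eq hQ hβ hA hfin, ← hd, Real.mul_rpow (by norm_num) dist_nonneg,
    Real.mul_rpow (by norm_num) measureReal_nonneg, Real.mul_rpow (by norm_num) measureReal_nonneg,
    smul_eq_mul, ← mul_add, mul_comm r, mul_comm r]
  ring

/-- Frullani with p = (2d)^β and q = (2μ(A_x))^β + (2μ(A_y))^β. The factor 2^β cancels in q/p, and x
≠ y ensures p > 0. -/
lemma gammaR_decomposition (hP' : ∀ r : ℝ, 0 < r → IsStablePoissonLaw μ β r (P' r))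
    (hβ : 0 < β) (hβ1 : β ≤ 1) (hA : ∀ x, MeasurableSet (A x)) (hfin : ∀ x, μ (A x) < ∞)
    (hd : ∀ x y, dist x y = μ.real (symmDiff (A x) (A y))) {x y : 𝕏} (hxy : x ≠ y) :
    IntegrableOn (fun r => gammaR A P' r x y / r) (Ioi 0) ∧
      Gam μ A β x y = 4 * ∫ r in Ioi (0 : ℝ), gammaR A P' r x y / r := by
  have hdpos : 0 < dist x y := dist_pos.2 hxy
  have h2 : (0 : ℝ) < 2 ^ β := by positivity
  have hp : 0 < 2 ^ β * dist x y ^ β := by positivity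
  have hpq : 2 ^ β * dist x y ^ β ≤ 2 ^ β * (μ.real (A x) ^ β + μ.real (A y) ^ β) := by
    have := measureReal_symmDiff_rpow_le hβ hβ1 hfin x y
    rw [← hd, Real.mul_rpow (by norm_num) dist_nonneg,
      Real.mul_rpow (by norm_num) measureReal_nonneg,
      Real.mul_rpow (by norm_num) measureReal_nonneg] at this
    linarith
  have heq : EqOn (fun r => 4⁻¹ * (r⁻¹ • (Real.exp (-((2 ^ β * dist x y ^ β) * r))
      - Real.exp (-((2 ^ β * (μ.real (A x) ^ β + μ.real (A y) ^ β)) * r)))))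
      (fun r => gammaR A P' r x y / r) (Ioi 0) := fun r hr =>
    (gammaR_div_eq (hP' r hr) hβ hA hfin hd x y).symm
  refine ⟨IntegrableOn.congr_fun ((integrableOn_exp_sub_exp_div hp hpq).const_mul _) heq
    measurableSet_Ioi, ?_⟩
  rw [← setIntegral_congr_fun measurableSet_Ioi heq, integral_const_mul,
    integral_exp_sub_exp_div hp hpq, Gam, mul_div_mul_left _ _ h2.ne']
  ring

end GammaBounds

/-- The standing assumptions on the measure definite metric and on the stable Poisson laws. -/
structure IsParityModel {E 𝕏 : Type*} [MeasurableSpace E] [MetricSpace 𝕏] [MeasurableSpace 𝕏]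
    {B : ℕ → Set E} (μ : Measure E) (A : 𝕏 → Set E) (β : ℝ) (P' : Kernel ℝ (PointMeasure B)) :
    Prop where
  isLocalizing : IsLocalizing μ B
  measurable_sections : MeasurableSet {p : 𝕏 × E | p.2 ∈ A p.1}
  lt_top : ∀ x, μ (A x) < ∞
  dist_eq : ∀ x y, dist x y = μ.real (symmDiff (A x) (A y))
  pos : 0 < β
  le_one : β ≤ 1
  stablePoisson : ∀ r : ℝ, 0 < r → IsStablePoissonLaw μ β r (P' r)

lemma IsLocalizing.sigmaFinite {E : Type*} [MeasurableSpace E] {μ : Measure E} {B : ℕ → Set E}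
    (hB : IsLocalizing μ B) : SigmaFinite μ :=
  ⟨⟨⟨B, fun _ => trivial, hB.measure_lt_top, hB.iUnion_eq⟩⟩⟩

lemma abs_gammaR_le {E 𝕏 : Type*} [MeasurableSpace E] {B : ℕ → Set E} {A : 𝕏 → Set E}
    {P' : Kernel ℝ (PointMeasure B)} [IsMarkovKernel P'] (r : ℝ) (x y : 𝕏) :
    |gammaR A P' r x y| ≤ 1 := by
  have := norm_integral_le_of_norm_le_const (μ := P' r) (C := 1)
    (f := fun m => centredOdd A P' r m x * centredOdd A P' r m y) (ae_of_all _ fun m => by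
      rw [norm_mul]
      exact mul_le_one₀ (abs_centredOdd_le _ _ _ _ _) (norm_nonneg _) (abs_centredOdd_le _ _ _ _ _))
  simpa [gammaR] using this

lemma abs_integrand_le {E 𝕏 : Type*} [MeasurableSpace E] [MeasurableSpace 𝕏] {B : ℕ → Set E}
    {A : 𝕏 → Set E} {P' : Kernel ℝ (PointMeasure B)} [IsMarkovKernel P'] {lam : Measure 𝕏}
    {f : 𝕏 → ℝ} (hf : Integrable f lam) (p : ℝ × PointMeasure B) :
    |integrand A lam P' f p| ≤ ∫ x, |f x| ∂lam := by
  refine norm_integral_le_of_norm_le (f := fun x => centredOdd A P' p.1 p.2 x * f x) hf.abs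
    (ae_of_all _ fun x => ?_)
  rw [norm_mul]
  exact mul_le_of_le_one_left (abs_nonneg _) (abs_centredOdd_le _ _ _ _ _)

/-! ### Second moments of the integrand -/

section SecondMoment

variable {E 𝕏 : Type*} [MeasurableSpace E] [MetricSpace 𝕏] [MeasurableSpace 𝕏]
  {B : ℕ → Set E} {μ : Measure E} {β : ℝ} {A : 𝕏 → Set E} {P' : Kernel ℝ (PointMeasure B)}
  {lam : Measure 𝕏}

namespace IsParityModel

lemma measurableSet (h : IsParityModel μ A β P') (x : 𝕏) : MeasurableSet (A x) :=
  measurable_prodMk_left (x := x) h.measurable_sections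

/-- Without separability, continuity of the distance does not give measurability for the product
σ-algebra. The distance is instead the mass of a measurable section. -/
lemma measurable_dist (h : IsParityModel μ A β P') :
    Measurable (fun p : 𝕏 × 𝕏 => dist p.1 p.2) := by
  have := h.isLocalizing.sigmaFinite
  simp_rw [h.dist_eq]
  have h1 : MeasurableSet {q : (𝕏 × 𝕏) × E | q.2 ∈ A q.1.1} :=
    h.measurable_sections.preimage (f := fun q : (𝕏 × 𝕏) × E => (q.1.1, q.2)) (by fun_prop)
  have h2 : MeasurableSet {q : (𝕏 × 𝕏) × E | q.2 ∈ A q.1.2} :=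
    h.measurable_sections.preimage (f := fun q : (𝕏 × 𝕏) × E => (q.1.2, q.2)) (by fun_prop)
  exact (measurable_measure_prodMk_left (h1.symmDiff h2)).ennreal_toReal

variable [IsMarkovKernel P']

lemma measurable_centredOdd (h : IsParityModel μ A β P') :
    Measurable (fun q : (ℝ × PointMeasure B) × 𝕏 => centredOdd A P' q.1.1 q.1.2 q.2) :=
  LogCorr.measurable_centredOdd h.isLocalizing h.measurable_sections P'

lemma measurable_gammaR (h : IsParityModel μ A β P') :
    Measurable (fun q : ℝ × (𝕏 × 𝕏) => gammaR A P' q.1 q.2.1 q.2.2) := by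
  have h1 : Measurable (fun q : (ℝ × (𝕏 × 𝕏)) × PointMeasure B =>
      centredOdd A P' q.1.1 q.2 q.1.2.1 * centredOdd A P' q.1.1 q.2 q.1.2.2) :=
    (h.measurable_centredOdd.comp (g := fun q : (ℝ × PointMeasure B) × 𝕏 => _)
      (f := fun q : (ℝ × (𝕏 × 𝕏)) × PointMeasure B => ((q.1.1, q.2), q.1.2.1)) (by fun_prop)).mul
    (h.measurable_centredOdd.comp (g := fun q : (ℝ × PointMeasure B) × 𝕏 => _)
      (f := fun q : (ℝ × (𝕏 × 𝕏)) × PointMeasure B => ((q.1.1, q.2), q.1.2.2)) (by fun_prop))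
  exact (h1.stronglyMeasurable.integral_kernel_prod_right'
    (κ := Kernel.prodMkRight (𝕏 × 𝕏) P')).measurable

lemma measurable_gammaR_right (h : IsParityModel μ A β P') (r : ℝ) :
    Measurable (fun p : 𝕏 × 𝕏 => gammaR A P' r p.1 p.2) :=
  h.measurable_gammaR.comp (measurable_prodMk_left (x := r))

lemma measurable_centredOdd_right (h : IsParityModel μ A β P') (r : ℝ) (m : PointMeasure B) :
    Measurable (fun x => centredOdd A P' r m x) :=
  h.measurable_centredOdd.comp (measurable_prodMk_left (x := (r, m)))

lemma integrable_centredOdd_mul (h : IsParityModel μ A β P') {f : 𝕏 → ℝ} (hf : Integrable f lam)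
    (r : ℝ) (m : PointMeasure B) : Integrable (fun x => centredOdd A P' r m x * f x) lam :=
  hf.bdd_mul (h.measurable_centredOdd_right r m).aestronglyMeasurable
    (ae_of_all _ fun _ => abs_centredOdd_le _ _ _ _ _)

lemma measurable_integrand [SFinite lam] (h : IsParityModel μ A β P') {f : 𝕏 → ℝ}
    (hf : Measurable f) : Measurable (integrand A lam P' f) :=
  ((h.measurable_centredOdd.mul (hf.comp measurable_snd)).stronglyMeasurable.integral_prod_right'
    (ν := lam)).measurable

end IsParityModel

namespace IsParityModel

variable [IsMarkovKernel P']

lemma integrable_mul_gammaR [SFinite lam] (h : IsParityModel μ A β P') {f g : 𝕏 → ℝ} (hf : Integrable f lam)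
    (hg : Integrable g lam) (r : ℝ) :
    Integrable (fun p : 𝕏 × 𝕏 => f p.1 * g p.2 * gammaR A P' r p.1 p.2) (lam.prod lam) :=
  (hf.mul_prod hg).mul_bdd (h.measurable_gammaR_right r).aestronglyMeasurable
    (ae_of_all _ fun _ => abs_gammaR_le _ _ _)

variable [SFinite lam]

lemma integrable_integrand_rpow (h : IsParityModel μ A β P') {f : 𝕏 → ℝ} (hfm : Measurable f)
    (hf : Integrable f lam) {α : ℝ} (hα : 0 ≤ α) (r : ℝ) :
    Integrable (fun m => |integrand A lam P' f (r, m)| ^ α) (P' r) := by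
  have hm : Measurable (fun m => integrand A lam P' f (r, m)) :=
    (h.measurable_integrand hfm).comp measurable_prodMk_left
  refine Integrable.of_bound (hm.abs.pow_const α).aestronglyMeasurable ((∫ x, |f x| ∂lam) ^ α) (ae_of_all _ fun m => ?_)
  rw [Real.norm_of_nonneg (by positivity)]
  exact Real.rpow_le_rpow (abs_nonneg _) (abs_integrand_le hf _) hα

lemma integrable_integrand_mul (h : IsParityModel μ A β P') {f g : 𝕏 → ℝ} (hfm : Measurable f)
    (hf : Integrable f lam) (hgm : Measurable g) (hg : Integrable g lam) (r : ℝ) :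
    Integrable (fun m => integrand A lam P' f (r, m) * integrand A lam P' g (r, m)) (P' r) := by
  have hm : Measurable (fun m => integrand A lam P' f (r, m)) :=
    (h.measurable_integrand hfm).comp measurable_prodMk_left
  have hm' : Measurable (fun m => integrand A lam P' g (r, m)) :=
    (h.measurable_integrand hgm).comp measurable_prodMk_left
  refine Integrable.of_bound (by fun_prop) ((∫ x, |f x| ∂lam) * ∫ x, |g x| ∂lam)
    (ae_of_all _ fun m => ?_)
  rw [norm_mul]
  exact mul_le_mul (abs_integrand_le hf _) (abs_integrand_le hg _) (norm_nonneg _)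
    (integral_nonneg fun _ => abs_nonneg _)

/-- Fubini: the centred indicators are bounded by 1, so |f(x) g(y)| dominates. This is the link
between the integrand and Γ_r. -/
lemma integral_integrand_mul (h : IsParityModel μ A β P') {f g : 𝕏 → ℝ} (hf : Integrable f lam)
    (hg : Integrable g lam) (r : ℝ) :
    ∫ m, integrand A lam P' f (r, m) * integrand A lam P' g (r, m) ∂(P' r)
      = ∫ p, f p.1 * g p.2 * gammaR A P' r p.1 p.2 ∂(lam.prod lam) := by
  have hmeas : Measurable (fun q : PointMeasure B × (𝕏 × 𝕏) =>
      centredOdd A P' r q.1 q.2.1 * centredOdd A P' r q.1 q.2.2) :=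
    (h.measurable_centredOdd.comp (g := fun q : (ℝ × PointMeasure B) × 𝕏 => _)
      (f := fun q : PointMeasure B × (𝕏 × 𝕏) => ((r, q.1), q.2.1)) (by fun_prop)).mul
    (h.measurable_centredOdd.comp (g := fun q : (ℝ × PointMeasure B) × 𝕏 => _)
      (f := fun q : PointMeasure B × (𝕏 × 𝕏) => ((r, q.1), q.2.2)) (by fun_prop))
  have hint : Integrable (fun q : PointMeasure B × (𝕏 × 𝕏) => f q.2.1 * g q.2.2 *
      (centredOdd A P' r q.1 q.2.1 * centredOdd A P' r q.1 q.2.2)) ((P' r).prod (lam.prod lam)) :=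
    ((hf.mul_prod hg).comp_snd (P' r)).mul_bdd (c := 1) hmeas.aestronglyMeasurable
      (ae_of_all _ fun q => by
        rw [norm_mul]
        exact mul_le_one₀ (abs_centredOdd_le _ _ _ _ _) (norm_nonneg _)
          (abs_centredOdd_le _ _ _ _ _))
  calc ∫ m, integrand A lam P' f (r, m) * integrand A lam P' g (r, m) ∂(P' r)
      = ∫ m, ∫ p : 𝕏 × 𝕏, f p.1 * g p.2 * (centredOdd A P' r m p.1 * centredOdd A P' r m p.2)
          ∂(lam.prod lam) ∂(P' r) := by
        refine integral_congr_ae (ae_of_all _ fun m => ?_)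
        simp only [integrand]
        rw [← integral_prod_mul]
        refine integral_congr_ae (ae_of_all _ fun p => ?_)
        simp only
        ring
    _ = ∫ p : 𝕏 × 𝕏, ∫ m, f p.1 * g p.2 * (centredOdd A P' r m p.1 * centredOdd A P' r m p.2)
          ∂(P' r) ∂(lam.prod lam) := integral_integral_swap hint
    _ = _ := by
        refine integral_congr_ae (ae_of_all _ fun p => ?_)
        simp only
        rw [integral_const_mul, gammaR]

end IsParityModel

end SecondMoment

/-! ### Integration against dr/r and the density 2/r -/

lemma integrableOn_div_of_le_rpow {q : ℝ → ℝ} (hq : AEStronglyMeasurable q (volume.restrict (Ioi 0)))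
    {C a b : ℝ} (ha : 0 < a) (hb : 0 < b) (h0 : ∀ r, 0 < r → 0 ≤ q r)
    (h1 : ∀ r, 0 < r → q r ≤ C * r ^ a) (h2 : ∀ r, 0 < r → q r ≤ C * r ^ (-b)) :
    IntegrableOn (fun r => q r / r) (Ioi 0) := by
  have hm : AEStronglyMeasurable (fun r => q r / r) (volume.restrict (Ioi 0)) :=
    (hq.aemeasurable.div aemeasurable_id').aestronglyMeasurable
  have key : ∀ (s : ℝ) (S : Set ℝ), MeasurableSet S → S ⊆ Ioi 0 →
      (∀ r, 0 < r → q r ≤ C * r ^ s) → IntegrableOn (fun r : ℝ => r ^ (s - 1)) S →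
      IntegrableOn (fun r => q r / r) S := by
    intro s S hS hsub hle hint
    refine Integrable.mono' (hint.const_mul C) (hm.mono_measure (Measure.restrict_mono hsub le_rfl))
      ((ae_restrict_mem hS).mono fun r hrS => ?_)
    have hr : 0 < r := hsub hrS
    rw [Real.norm_of_nonneg (div_nonneg (h0 r hr) hr.le), Real.rpow_sub_one hr.ne', mul_div_assoc']
    exact div_le_div_of_nonneg_right (hle r hr) hr.le
  -- Split at 1: the exponent a - 1 > -1 is integrable at the origin, and -b - 1 < -1 at infinity.
  rw [← Ioc_union_Ioi_eq_Ioi (zero_le_one' ℝ)]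
  refine IntegrableOn.union (key a _ measurableSet_Ioc Ioc_subset_Ioi_self h1 ?_)
    (key (-b) _ measurableSet_Ioi (Ioi_subset_Ioi zero_le_one) h2 ?_)
  · exact (intervalIntegrable_iff_integrableOn_Ioc_of_le zero_le_one).1
      (intervalIntegral.intervalIntegrable_rpow' (by linarith))
  · exact integrableOn_Ioi_rpow_of_lt (by linarith) one_pos

lemma integrable_withDensity_two_div_iff {q : ℝ → ℝ} :
    Integrable q ((volume.restrict (Ioi (0 : ℝ))).withDensity (fun r => ENNReal.ofReal (2 / r)))
      ↔ IntegrableOn (fun r => q r / r) (Ioi 0) := by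
  rw [integrable_withDensity_iff_integrable_smul' (by fun_prop)
    (ae_of_all _ fun _ => ENNReal.ofReal_lt_top), IntegrableOn]
  have h : (fun r => (ENNReal.ofReal (2 / r)).toReal • q r)
      =ᵐ[volume.restrict (Ioi (0 : ℝ))] fun r => 2 * (q r / r) := by
    filter_upwards [ae_restrict_mem measurableSet_Ioi] with r hr
    rw [ENNReal.toReal_ofReal (div_nonneg zero_le_two (le_of_lt hr)), smul_eq_mul]
    ring
  rw [integrable_congr h]
  exact integrable_const_mul_iff (isUnit_iff_ne_zero.2 two_ne_zero) _

lemma integral_withDensity_two_div (q : ℝ → ℝ) :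
    ∫ r, q r ∂((volume.restrict (Ioi (0 : ℝ))).withDensity (fun r => ENNReal.ofReal (2 / r)))
      = 2 * ∫ r in Ioi (0 : ℝ), q r / r := by
  rw [integral_withDensity_eq_integral_toReal_smul (by fun_prop)
    (ae_of_all _ fun _ => ENNReal.ofReal_lt_top), ← integral_const_mul]
  refine integral_congr_ae ?_
  filter_upwards [ae_restrict_mem measurableSet_Ioi] with r hr
  rw [ENNReal.toReal_ofReal (div_nonneg zero_le_two (le_of_lt hr)), smul_eq_mul]
  ring

/-! ### Test functions put the integrand in L^α -/

section TestFunctions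

variable {E 𝕏 : Type*} [MeasurableSpace E] [MetricSpace 𝕏] [MeasurableSpace 𝕏]
  {B : ℕ → Set E} {μ : Measure E} {β : ℝ} {A : 𝕏 → Set E} {P' : Kernel ℝ (PointMeasure B)}
  {lam : Measure 𝕏} {δ δ' : ℝ}

namespace IsParityModel

lemma integrable_exp_dist (h : IsParityModel μ A β P') {f : 𝕏 → ℝ} (hf : Integrable f lam)
    {r : ℝ} (hr : 0 ≤ r) :
    Integrable (fun p : 𝕏 × 𝕏 => Real.exp (-((dist p.1 p.2) ^ β * r)) * |f p.1 * f p.2|)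
      (lam.prod lam) := by
  refine (hf.mul_prod hf).abs.bdd_mul (c := 1) ?_ (ae_of_all _ fun p => ?_)
  · exact (((h.measurable_dist.pow_const β).mul_const r).neg.exp).aestronglyMeasurable
  · rw [Real.norm_of_nonneg (Real.exp_pos _).le, Real.exp_le_one_iff, neg_nonpos]
    exact mul_nonneg (Real.rpow_nonneg dist_nonneg _) hr

variable [SFinite lam]

lemma exists_decay (h : IsParityModel μ A β P') {f : 𝕏 → ℝ}
    (hf : IsTestFunction μ A lam δ δ' β f) :
    ∃ C : ℝ, ∀ r : ℝ, 0 < r →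
      ∫ p : 𝕏 × 𝕏, Real.exp (-((dist p.1 p.2) ^ β * r)) * |f p.1 * f p.2| ∂(lam.prod lam)
        ≤ C * r ^ (-δ') := by
  obtain ⟨C, hC⟩ := hf.decay
  refine ⟨C, fun r hr => ?_⟩
  rw [integral_prod _ (h.integrable_exp_dist hf.integrable hr.le)]
  exact hC r hr

/-- On the diagonal the exponential in the decay hypothesis is 1 for every r, so the mass of |f(x)
f(y)| there is at most C r^{-δ'}, which tends to 0. -/
lemma ae_diagonal_mul_self (h : IsParityModel μ A β P') (hδ' : 0 < δ') {f : 𝕏 → ℝ}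
    (hf : IsTestFunction μ A lam δ δ' β f) :
    ∀ᵐ p ∂(lam.prod lam), p.1 = p.2 → f p.1 * f p.2 = 0 := by
  obtain ⟨C, hC⟩ := h.exists_decay hf
  set D : Set (𝕏 × 𝕏) := {p | dist p.1 p.2 = 0} with hD
  have hDm : MeasurableSet D := h.measurable_dist (measurableSet_singleton 0)
  have hint : Integrable (fun p : 𝕏 × 𝕏 => |f p.1 * f p.2|) (lam.prod lam) :=
    (hf.integrable.mul_prod hf.integrable).abs
  have hle : ∀ r : ℝ, 0 < r → ∫ p in D, |f p.1 * f p.2| ∂(lam.prod lam) ≤ C * r ^ (-δ') := by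
    intro r hr
    refine le_trans ?_ (hC r hr)
    rw [← integral_indicator hDm]
    refine integral_mono (hint.indicator hDm) (h.integrable_exp_dist hf.integrable hr.le)
      fun p => ?_
    by_cases hp : p ∈ D
    · have hp' : dist p.1 p.2 = 0 := hp
      simp [indicator_of_mem hp, hp', Real.zero_rpow h.pos.ne']
    · rw [indicator_of_notMem hp]
      positivity
  have hlim : Tendsto (fun r : ℝ => C * r ^ (-δ')) atTop (𝓝 0) := by
    simpa using (tendsto_rpow_neg_atTop hδ').const_mul C
  have h0 : ∫ p in D, |f p.1 * f p.2| ∂(lam.prod lam) = 0 :=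
    le_antisymm (ge_of_tendsto hlim ((eventually_gt_atTop 0).mono hle))
      (integral_nonneg fun _ => abs_nonneg _)
  rw [setIntegral_eq_zero_iff_of_nonneg_ae (ae_of_all _ fun _ => abs_nonneg _)
    hint.integrableOn, EventuallyEq, ae_restrict_iff' hDm] at h0
  filter_upwards [h0] with p hp hpq
  exact abs_eq_zero.1 (hp (by rw [hD, mem_ofPred_eq, hpq, dist_self]))

/-- At almost every diagonal point f(x)² = 0, hence f(x) = 0, whatever g is. -/
lemma ae_diagonal (h : IsParityModel μ A β P') (hδ' : 0 < δ') {f : 𝕏 → ℝ} (g : 𝕏 → ℝ)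
    (hf : IsTestFunction μ A lam δ δ' β f) :
    ∀ᵐ p ∂(lam.prod lam), p.1 = p.2 → f p.1 * g p.2 = 0 := by
  filter_upwards [h.ae_diagonal_mul_self hδ' hf] with p hp hpq
  have h1 := hp hpq
  rw [← hpq] at h1
  rw [mul_self_eq_zero.1 h1, zero_mul]

variable [IsMarkovKernel P']

/-- The second moment bound: it decays like a power of `r` at zero and at infinity. -/
lemma exists_gammaR_bounds (h : IsParityModel μ A β P') (hδ : 0 < δ) {f : 𝕏 → ℝ}
    (hf : IsTestFunction μ A lam δ δ' β f) :
    ∃ C ε : ℝ, 0 ≤ C ∧ 0 < ε ∧ ∀ r : ℝ, 0 < r →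
      ∫ p, |f p.1| * |f p.2| * gammaR A P' r p.1 p.2 ∂(lam.prod lam) ≤ C * r ^ ε ∧
      ∫ p, |f p.1| * |f p.2| * gammaR A P' r p.1 p.2 ∂(lam.prod lam) ≤ C * r ^ (-δ') := by
  obtain ⟨C, hC⟩ := h.exists_decay hf
  -- ε ≤ 1 is needed for 1 - e^{-t} ≤ t^ε and subadditivity, βε ≤ δ for the weight to be integrable.
  set ε := min 1 (δ / β) with hε
  have hεpos : 0 < ε := lt_min one_pos (div_pos hδ h.pos)
  have hεδ : β * ε ≤ δ := by
    have := mul_le_mul_of_nonneg_left (min_le_right 1 (δ / β)) h.pos.le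
    rwa [mul_div_cancel₀ _ h.pos.ne'] at this
  set w : 𝕏 → ℝ := fun x => 1 + μ.real (A x) ^ δ with hw
  have hfw : Integrable (fun x => |f x| * w x) lam := by
    have := hf.integrable.abs.add hf.integrable_weight
    refine this.congr (ae_of_all _ fun x => ?_)
    simp only [Pi.add_apply, hw]
    ring
  have hfa := hf.integrable.abs
  have hint := h.integrable_mul_gammaR (P' := P') hfa hfa
  have hWint : Integrable (fun p : 𝕏 × 𝕏 => |f p.1| * |f p.2| * (w p.1 + w p.2))
      (lam.prod lam) := by
    refine ((hfw.mul_prod hfa).add (hfa.mul_prod hfw)).congr (ae_of_all _ fun p => ?_)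
    simp only [Pi.add_apply]
    ring
  set W := ∫ p : 𝕏 × 𝕏, |f p.1| * |f p.2| * (w p.1 + w p.2) ∂(lam.prod lam) with hWdef
  have b1 : ∀ r : ℝ, 0 < r →
      ∫ p, |f p.1| * |f p.2| * gammaR A P' r p.1 p.2 ∂(lam.prod lam) ≤ (2 ^ δ * W) * r ^ ε := by
    intro r hr
    have : (2 ^ δ * W) * r ^ ε
        = ∫ p : 𝕏 × 𝕏, (r ^ ε * 2 ^ δ) * (|f p.1| * |f p.2| * (w p.1 + w p.2)) ∂(lam.prod lam) := by
      rw [integral_const_mul]; ring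
    rw [this]
    refine integral_mono (hint r) (hWint.const_mul _) fun p => ?_
    have := mul_le_mul_of_nonneg_left (gammaR_le_rpow (h.stablePoisson r hr) hr h.pos
      h.measurableSet h.lt_top hεpos (min_le_left _ _) hεδ p.1 p.2)
      (mul_nonneg (abs_nonneg (f p.1)) (abs_nonneg (f p.2)))
    refine this.trans (le_of_eq ?_)
    simp only [hw]
    ring
  have b2 : ∀ r : ℝ, 0 < r →
      ∫ p, |f p.1| * |f p.2| * gammaR A P' r p.1 p.2 ∂(lam.prod lam)
        ≤ (C * (2 ^ β) ^ (-δ')) * r ^ (-δ') := by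
    intro r hr
    -- The exponent of Γ_r contains (2d)^β rather than d^β, so the decay hypothesis is used at time
    -- 2^β r.
    have hr2 : 0 < 2 ^ β * r := by positivity
    refine le_trans ?_ ((hC _ hr2).trans (le_of_eq ?_))
    · refine integral_mono (hint r) (h.integrable_exp_dist hf.integrable hr2.le) fun p => ?_
      have := mul_le_mul_of_nonneg_left (gammaR_le_exp (h.stablePoisson r hr) h.pos
        h.measurableSet h.lt_top p.1 p.2)
        (mul_nonneg (abs_nonneg (f p.1)) (abs_nonneg (f p.2)))
      refine this.trans (le_of_eq ?_)
      rw [← h.dist_eq, abs_mul]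
      ring
    · rw [Real.mul_rpow (by positivity) hr.le, mul_assoc]
  -- One nonnegative constant serves both bounds, so that it can later be raised to the power α/2.
  refine ⟨max 0 (max (2 ^ δ * W) (C * (2 ^ β) ^ (-δ'))), ε, le_max_left _ _, hεpos, fun r hr =>
    ⟨(b1 r hr).trans ?_, (b2 r hr).trans ?_⟩⟩
  · exact mul_le_mul_of_nonneg_right ((le_max_left _ _).trans (le_max_right _ _)) (by positivity)
  · exact mul_le_mul_of_nonneg_right ((le_max_right _ _).trans (le_max_right _ _)) (by positivity)

/-- Because Γ_r ≥ 0, replacing f(x) f(y) by its absolute value can only increase the double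
integral. -/
lemma integral_integrand_sq_le (h : IsParityModel μ A β P') {f : 𝕏 → ℝ}
    (hf : Integrable f lam) {r : ℝ} (hr : 0 < r) :
    ∫ m, |integrand A lam P' f (r, m)| ^ (2 : ℝ) ∂(P' r)
      ≤ ∫ p, |f p.1| * |f p.2| * gammaR A P' r p.1 p.2 ∂(lam.prod lam) := by
  simp_rw [Real.rpow_two, sq_abs, sq]
  rw [h.integral_integrand_mul hf hf]
  refine integral_mono (h.integrable_mul_gammaR hf hf r)
    (h.integrable_mul_gammaR hf.abs hf.abs r) fun p => ?_
  refine mul_le_mul_of_nonneg_right ?_ (gammaR_nonneg (h.stablePoisson r hr) hr h.pos h.le_one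
    h.measurableSet h.lt_top _ _)
  rw [← abs_mul]
  exact le_abs_self _

/-- Jensen for the concave map t ↦ t^{α/2} under the probability measure P'_r. -/
lemma integral_integrand_rpow_le (h : IsParityModel μ A β P') {f : 𝕏 → ℝ} (hfm : Measurable f)
    (hf : Integrable f lam) {α : ℝ} (hα : 0 < α) (hα2 : α ≤ 2) (r : ℝ) :
    ∫ m, |integrand A lam P' f (r, m)| ^ α ∂(P' r)
      ≤ (∫ m, |integrand A lam P' f (r, m)| ^ (2 : ℝ) ∂(P' r)) ^ (α / 2) := by
  have hcomp : ∀ m, (|integrand A lam P' f (r, m)| ^ (2 : ℝ)) ^ (α / 2)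
      = |integrand A lam P' f (r, m)| ^ α := fun m => by
    rw [← Real.rpow_mul (abs_nonneg _)]; congr 1; ring
  have := ConcaveOn.le_map_integral (μ := P' r) (s := Ici (0 : ℝ))
    (f := fun m => |integrand A lam P' f (r, m)| ^ (2 : ℝ))
    (Real.concaveOn_rpow (p := α / 2) (by positivity) (by linarith))
    (Real.continuous_rpow_const (by positivity)).continuousOn isClosed_Ici
    (ae_of_all _ fun m => by simp only [mem_Ici]; positivity)
    (h.integrable_integrand_rpow hfm hf zero_le_two r)
    (by
      refine (h.integrable_integrand_rpow hfm hf hα.le r).congr (ae_of_all _ fun m => ?_)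
      exact (hcomp m).symm)
  simpa only [hcomp] using this

lemma measurable_integral_integrand_rpow (h : IsParityModel μ A β P') {f : 𝕏 → ℝ}
    (hfm : Measurable f) (α : ℝ) :
    Measurable (fun r => ∫ m, |integrand A lam P' f (r, m)| ^ α ∂(P' r)) :=
  (((h.measurable_integrand (lam := lam) hfm).abs.pow_const α).stronglyMeasurable
    |>.integral_kernel_prod_right' (κ := P')).measurable

lemma integrableOn_integrand_rpow_div (h : IsParityModel μ A β P') (hδ : 0 < δ) (hδ' : 0 < δ')
    {f : 𝕏 → ℝ} (hf : IsTestFunction μ A lam δ δ' β f) {α : ℝ} (hα : 0 < α) (hα2 : α ≤ 2) :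
    IntegrableOn (fun r => (∫ m, |integrand A lam P' f (r, m)| ^ α ∂(P' r)) / r) (Ioi 0) := by
  obtain ⟨C, ε, hC0, hε, hC⟩ := h.exists_gammaR_bounds hδ hf
  have key : ∀ (r s : ℝ), 0 < r →
      ∫ p, |f p.1| * |f p.2| * gammaR A P' r p.1 p.2 ∂(lam.prod lam) ≤ C * r ^ s →
      ∫ m, |integrand A lam P' f (r, m)| ^ α ∂(P' r) ≤ C ^ (α / 2) * r ^ (s * (α / 2)) := by
    intro r s hr hle
    refine (h.integral_integrand_rpow_le hf.measurable hf.integrable hα hα2 r).trans ?_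
    rw [Real.rpow_mul hr.le, ← Real.mul_rpow hC0 (by positivity)]
    exact Real.rpow_le_rpow (integral_nonneg fun _ => by positivity)
      ((h.integral_integrand_sq_le hf.integrable hr).trans hle) (by positivity)
  refine integrableOn_div_of_le_rpow (C := C ^ (α / 2)) (a := ε * (α / 2)) (b := δ' * (α / 2))
    (h.measurable_integral_integrand_rpow hf.measurable α).aestronglyMeasurable
    (by positivity) (by positivity) (fun r _ => integral_nonneg fun _ => by positivity)
    (fun r hr => key r ε hr (hC r hr).1) (fun r hr => ?_)
  have := key r (-δ') hr (hC r hr).2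
  rwa [neg_mul] at this

lemma integrable_integrand_rpow_controlMeasure (h : IsParityModel μ A β P') (hδ : 0 < δ)
    (hδ' : 0 < δ') {f : 𝕏 → ℝ} (hf : IsTestFunction μ A lam δ δ' β f) {α : ℝ} (hα : 0 < α)
    (hα2 : α ≤ 2) :
    Integrable (fun p => |integrand A lam P' f p| ^ α) (controlMeasure P') := by
  have hm := (h.measurable_integrand (lam := lam) hf.measurable).abs.pow_const α
  rw [controlMeasure, Measure.integrable_compProd_iff hm.aestronglyMeasurable]
  refine ⟨ae_of_all _ fun r => h.integrable_integrand_rpow hf.measurable hf.integrable hα.le r, ?_⟩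
  have : ∀ r m, ‖|integrand A lam P' f (r, m)| ^ α‖ = |integrand A lam P' f (r, m)| ^ α :=
    fun r m => Real.norm_of_nonneg (by positivity)
  simp_rw [this]
  exact integrable_withDensity_two_div_iff.2 (h.integrableOn_integrand_rpow_div hδ hδ' hf hα hα2)

lemma integral_integrand_rpow_controlMeasure (h : IsParityModel μ A β P') (hδ : 0 < δ)
    (hδ' : 0 < δ') {f : 𝕏 → ℝ} (hf : IsTestFunction μ A lam δ δ' β f) {α : ℝ} (hα : 0 < α)
    (hα2 : α ≤ 2) :
    ∫ p, |integrand A lam P' f p| ^ α ∂(controlMeasure P')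
      = 2 * ∫ r in Ioi (0 : ℝ), (∫ m, |integrand A lam P' f (r, m)| ^ α ∂(P' r)) / r := by
  have := h.integrable_integrand_rpow_controlMeasure hδ hδ' hf hα hα2
  rw [controlMeasure] at this ⊢
  rw [Measure.integral_compProd this, integral_withDensity_two_div]

lemma memLp_integrand (h : IsParityModel μ A β P') (hδ : 0 < δ)
    (hδ' : 0 < δ') {f : 𝕏 → ℝ} (hf : IsTestFunction μ A lam δ δ' β f) {α : ℝ} (hα : 0 < α)
    (hα2 : α ≤ 2) :
    MemLp (integrand A lam P' f) (ENNReal.ofReal α) (controlMeasure P') := by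
  rw [← integrable_norm_rpow_iff
    (h.measurable_integrand (lam := lam) hf.measurable).aestronglyMeasurable
    (by simpa using hα) ENNReal.ofReal_ne_top, ENNReal.toReal_ofReal hα.le]
  exact h.integrable_integrand_rpow_controlMeasure hδ hδ' hf hα hα2

end IsParityModel

end TestFunctions

/-! ### The logarithmic kernel as an integral over r -/

section LogKernel

variable {E 𝕏 : Type*} [MeasurableSpace E] [MetricSpace 𝕏] [MeasurableSpace 𝕏]
  {B : ℕ → Set E} {μ : Measure E} {β : ℝ} {A : 𝕏 → Set E} {P' : Kernel ℝ (PointMeasure B)}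
  [IsMarkovKernel P'] {lam : Measure 𝕏} [SFinite lam] {δ δ' : ℝ}

namespace IsParityModel

lemma measurable_mul_gammaR_div (h : IsParityModel μ A β P') {f g : 𝕏 → ℝ} (hf : Measurable f)
    (hg : Measurable g) :
    Measurable (fun q : ℝ × (𝕏 × 𝕏) => f q.2.1 * g q.2.2 * gammaR A P' q.1 q.2.1 q.2.2 / q.1) :=
  (((hf.comp measurable_snd.fst).mul (hg.comp measurable_snd.snd)).mul h.measurable_gammaR).div
    measurable_fst

lemma integrableOn_integral_gammaR_div (h : IsParityModel μ A β P') (hδ : 0 < δ) (hδ' : 0 < δ')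
    {f : 𝕏 → ℝ} (hf : IsTestFunction μ A lam δ δ' β f) :
    IntegrableOn (fun r => (∫ p, |f p.1| * |f p.2| * gammaR A P' r p.1 p.2 ∂(lam.prod lam)) / r)
      (Ioi 0) := by
  obtain ⟨C, ε, -, hε, hC⟩ := h.exists_gammaR_bounds hδ hf
  have hm : Measurable (fun q : ℝ × (𝕏 × 𝕏) =>
      |f q.2.1| * |f q.2.2| * gammaR A P' q.1 q.2.1 q.2.2) :=
    ((hf.measurable.abs.comp measurable_snd.fst).mul
      (hf.measurable.abs.comp measurable_snd.snd)).mul h.measurable_gammaR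
  refine integrableOn_div_of_le_rpow hm.stronglyMeasurable.integral_prod_right'.aestronglyMeasurable
    hε hδ' (fun r hr => integral_nonneg fun p => ?_) (fun r hr => (hC r hr).1)
    (fun r hr => (hC r hr).2)
  exact mul_nonneg (by positivity) (gammaR_nonneg (h.stablePoisson r hr) hr h.pos h.le_one
    h.measurableSet h.lt_top _ _)

/-- The decay hypothesis concerns one function at a time. Mixed terms are controlled by reading all
three integrals as moments of the integrands of |f| and |g| and applying 2ab ≤ a² + b². -/
lemma integral_abs_mul_gammaR_le (h : IsParityModel μ A β P') {f g : 𝕏 → ℝ}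
    (hf : IsTestFunction μ A lam δ δ' β f) (hg : IsTestFunction μ A lam δ δ' β g) (r : ℝ) :
    ∫ p, |f p.1| * |g p.2| * gammaR A P' r p.1 p.2 ∂(lam.prod lam)
      ≤ 2⁻¹ * (∫ p, |f p.1| * |f p.2| * gammaR A P' r p.1 p.2 ∂(lam.prod lam)
        + ∫ p, |g p.1| * |g p.2| * gammaR A P' r p.1 p.2 ∂(lam.prod lam)) := by
  have hf' := hf.integrable.abs
  have hg' := hg.integrable.abs
  have hfm := hf.measurable.abs
  have hgm := hg.measurable.abs
  rw [← h.integral_integrand_mul hf' hg', ← h.integral_integrand_mul hf' hf',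
    ← h.integral_integrand_mul hg' hg', ← integral_add
      (h.integrable_integrand_mul hfm hf' hfm hf' r) (h.integrable_integrand_mul hgm hg' hgm hg' r),
    ← integral_const_mul]
  refine integral_mono (h.integrable_integrand_mul hfm hf' hgm hg' r)
    (((h.integrable_integrand_mul hfm hf' hfm hf' r).add
      (h.integrable_integrand_mul hgm hg' hgm hg' r)).const_mul _) fun m => ?_
  simp only
  nlinarith [sq_nonneg (integrand A lam P' (fun x => |f x|) (r, m)
    - integrand A lam P' (fun x => |g x|) (r, m))]

/-- Absolute integrability in (r, x, y) justifies the exchange of dr/r with λ ⊗ λ, and yields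
integrability of the logarithmic kernel. -/
lemma integrable_mul_gammaR_div_prod (h : IsParityModel μ A β P') (hδ : 0 < δ) (hδ' : 0 < δ')
    {f g : 𝕏 → ℝ} (hf : IsTestFunction μ A lam δ δ' β f)
    (hg : IsTestFunction μ A lam δ δ' β g) :
    Integrable (fun q : ℝ × (𝕏 × 𝕏) => f q.2.1 * g q.2.2 * gammaR A P' q.1 q.2.1 q.2.2 / q.1)
      ((volume.restrict (Ioi (0 : ℝ))).prod (lam.prod lam)) := by
  have hm := h.measurable_mul_gammaR_div (P' := P') hf.measurable hg.measurable
  rw [integrable_prod_iff hm.aestronglyMeasurable]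
  refine ⟨ae_of_all _ fun r =>
    (h.integrable_mul_gammaR hf.integrable hg.integrable r).div_const r, ?_⟩
  refine Integrable.mono' (((h.integrableOn_integral_gammaR_div (P' := P') hδ hδ' hf).add
    (h.integrableOn_integral_gammaR_div hδ hδ' hg)).const_mul 2⁻¹)
    hm.norm.stronglyMeasurable.integral_prod_right'.aestronglyMeasurable ?_
  filter_upwards [ae_restrict_mem measurableSet_Ioi] with r hr
  have hr : 0 < r := hr
  rw [Real.norm_of_nonneg (integral_nonneg fun _ => norm_nonneg _)]
  have h1 : ∀ p : 𝕏 × 𝕏, ‖f p.1 * g p.2 * gammaR A P' r p.1 p.2 / r‖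
      = |f p.1| * |g p.2| * gammaR A P' r p.1 p.2 / r := by
    intro p
    rw [norm_div, norm_mul, norm_mul, Real.norm_of_nonneg hr.le,
      Real.norm_of_nonneg (gammaR_nonneg (h.stablePoisson r hr) hr h.pos h.le_one
        h.measurableSet h.lt_top _ _)]
    rfl
  simp_rw [h1]
  rw [integral_div]
  refine (div_le_div_of_nonneg_right (h.integral_abs_mul_gammaR_le hf hg r) hr.le).trans
    (le_of_eq ?_)
  simp only [Pi.add_apply]
  ring

/-- Off the diagonal this is the Frullani decomposition. On it `Gam` has only a conventional value,
which is harmless since f(x) g(y) vanishes almost everywhere there. -/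
lemma ae_integral_mul_gammaR_div (h : IsParityModel μ A β P') (hδ' : 0 < δ')
    {f : 𝕏 → ℝ} (g : 𝕏 → ℝ) (hf : IsTestFunction μ A lam δ δ' β f) :
    ∀ᵐ p : 𝕏 × 𝕏 ∂(lam.prod lam),
      4 * ∫ r in Ioi (0 : ℝ), f p.1 * g p.2 * gammaR A P' r p.1 p.2 / r
        = f p.1 * g p.2 * Gam μ A β p.1 p.2 := by
  filter_upwards [h.ae_diagonal hδ' g hf] with p hp
  by_cases hpq : p.1 = p.2
  · simp [hp hpq]
  · rw [(gammaR_decomposition h.stablePoisson h.pos h.le_one h.measurableSet h.lt_top h.dist_eq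
      hpq).2]
    simp_rw [mul_div_assoc]
    rw [integral_const_mul]
    ring

lemma integrable_mul_gam (h : IsParityModel μ A β P') (hδ : 0 < δ) (hδ' : 0 < δ')
    {f g : 𝕏 → ℝ} (hf : IsTestFunction μ A lam δ δ' β f)
    (hg : IsTestFunction μ A lam δ δ' β g) :
    Integrable (fun p : 𝕏 × 𝕏 => f p.1 * g p.2 * Gam μ A β p.1 p.2) (lam.prod lam) :=
  ((h.integrable_mul_gammaR_div_prod (P' := P') hδ hδ' hf hg).integral_prod_right.const_mul
    4).congr (h.ae_integral_mul_gammaR_div hδ' g hf)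

/-- The 4 of the decomposition splits as 2 · 2: one factor is the density 2/r of the control
measure, the other remains and will match the Gaussian variance 2∫g². -/
lemma integral_mul_gam (h : IsParityModel μ A β P') (hδ : 0 < δ) (hδ' : 0 < δ')
    {f g : 𝕏 → ℝ} (hf : IsTestFunction μ A lam δ δ' β f)
    (hg : IsTestFunction μ A lam δ δ' β g) :
    ∫ x, ∫ y, f x * g y * Gam μ A β x y ∂lam ∂lam
      = 2 * ∫ p, integrand A lam P' f p * integrand A lam P' g p ∂(controlMeasure P') := by
  have hint : Integrable (fun p => integrand A lam P' f p * integrand A lam P' g p)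
      (controlMeasure P') := by
    have h2 : (ENNReal.ofReal (2 : ℝ)) = 2 := by simp
    have h1 := h.memLp_integrand hδ hδ' hf zero_lt_two le_rfl
    have h3 := h.memLp_integrand hδ hδ' hg zero_lt_two le_rfl
    rw [h2] at h1 h3
    exact h1.integrable_mul h3
  have e1 : ∫ x, ∫ y, f x * g y * Gam μ A β x y ∂lam ∂lam
      = ∫ p : 𝕏 × 𝕏, f p.1 * g p.2 * Gam μ A β p.1 p.2 ∂(lam.prod lam) :=
    (integral_prod _ (h.integrable_mul_gam hδ hδ' hf hg)).symm
  rw [e1, ← integral_congr_ae (h.ae_integral_mul_gammaR_div hδ' g hf), integral_const_mul,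
    ← integral_integral_swap (f := fun r (p : 𝕏 × 𝕏) => f p.1 * g p.2 * gammaR A P' r p.1 p.2 / r)
      (h.integrable_mul_gammaR_div_prod hδ hδ' hf hg)]
  rw [controlMeasure] at hint ⊢
  rw [Measure.integral_compProd hint, integral_withDensity_two_div]
  simp_rw [h.integral_integrand_mul hf.integrable hg.integrable, integral_div]
  ring

end IsParityModel

end LogKernel

/-! ### Stable random measures and integrals of simple functions -/

section StableMeasure

variable {Ω X : Type*} [MeasurableSpace Ω] [MeasurableSpace X] {α : ℝ} {m : Measure X}
  {M : Set X → Ω → ℝ} {Pr : Measure Ω}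

lemma charFun_map_eq {Y : Ω → ℝ} (hY : AEMeasurable Y Pr) (θ : ℝ) :
    charFun (Pr.map Y) θ = ∫ ω, Complex.exp (Complex.I * ((θ * Y ω : ℝ) : ℂ)) ∂Pr := by
  rw [charFun_apply_real, integral_map hY (by fun_prop)]
  refine integral_congr_ae (ae_of_all _ fun ω => ?_)
  simp only
  congr 1
  push_cast
  ring

/-- The `α`-th power of the `L^α` (quasi)norm. -/
def alphaEnergy (α : ℝ) (m : Measure X) (g : X → ℝ) : ℝ≥0∞ := ∫⁻ x, ‖g x‖ₑ ^ α ∂m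

namespace IsSymmStableRandomMeasure

lemma ae_empty (hM : IsSymmStableRandomMeasure α m M Pr) : ∀ᵐ ω ∂Pr, M ∅ ω = 0 := by
  have h := hM.sigma_additive (fun _ => ∅) (fun _ => MeasurableSet.empty) (by simp)
    (fun _ _ _ => disjoint_bot_left)
  filter_upwards [h] with ω hω
  simp only [iUnion_empty, Finset.sum_const, Finset.card_range, nsmul_eq_mul] at hω
  -- With every set empty the partial sums are n M(∅); they converge, so their constant increment
  -- M(∅) is 0.
  have h1 := (hω.comp (tendsto_add_atTop_nat 1)).sub hω
  have h2 : ((fun n : ℕ => (n : ℝ) * M ∅ ω) ∘ fun a => a + 1) - (fun n : ℕ => (n : ℝ) * M ∅ ω)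
      = fun _ => M ∅ ω := by
    ext n
    simp only [Pi.sub_apply, Function.comp_apply]
    push_cast
    ring
  have h3 : Tendsto (fun _ : ℕ => M ∅ ω) atTop (𝓝 (M ∅ ω - M ∅ ω)) := h2 ▸ h1
  rw [sub_self] at h3
  exact tendsto_nhds_unique tendsto_const_nhds h3

lemma ae_union (hM : IsSymmStableRandomMeasure α m M Pr) {S T : Set X} (hS : MeasurableSet S)
    (hT : MeasurableSet T) (hd : Disjoint S T) (hfin : m (S ∪ T) < ∞) :
    ∀ᵐ ω ∂Pr, M (S ∪ T) ω = M S ω + M T ω := by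
  set U : ℕ → Set X := fun n => if n = 0 then S else if n = 1 then T else ∅ with hU
  have hUnion : ⋃ n, U n = S ∪ T := by
    ext x
    simp only [mem_iUnion, hU, mem_union]
    constructor
    · rintro ⟨n, hn⟩
      split_ifs at hn
      · exact Or.inl hn
      · exact Or.inr hn
      · exact hn.elim
    · rintro (hx | hx)
      · exact ⟨0, by simpa using hx⟩
      · exact ⟨1, by simpa using hx⟩
  have h := hM.sigma_additive U (fun n => by simp only [hU]; split_ifs <;> simp [hS, hT])
    (by rwa [hUnion]) (fun i j hij => by
      simp only [hU]
      split_ifs with h1 h2 h3 h4 h5 h6 h7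
      all_goals first
        | exact hd
        | exact hd.symm
        | exact disjoint_bot_left
        | exact disjoint_bot_right
        | (exfalso; omega))
  filter_upwards [h, hM.ae_empty] with ω hω h0
  rw [hUnion] at hω
  have h1 : ∀ n, ∑ i ∈ Finset.range (n + 2), M (U i) ω = M S ω + M T ω := by
    intro n
    rw [Finset.sum_range_succ', Finset.sum_range_succ']
    simp [hU, h0, add_comm]
  refine tendsto_nhds_unique ((tendsto_add_atTop_iff_nat 2).2 hω) ?_
  simp_rw [h1]
  exact tendsto_const_nhds

lemma ae_biUnion (hM : IsSymmStableRandomMeasure α m M Pr) {ι : Type*} (s : Finset ι)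
    (S : ι → Set X) (hS : ∀ i ∈ s, MeasurableSet (S i)) (hfin : ∀ i ∈ s, m (S i) < ∞)
    (hd : (s : Set ι).PairwiseDisjoint S) :
    ∀ᵐ ω ∂Pr, M (⋃ i ∈ s, S i) ω = ∑ i ∈ s, M (S i) ω := by
  classical
  induction s using Finset.induction_on with
  | empty => simpa using hM.ae_empty
  | insert i s hi ih =>
    have ih' := ih (fun j hj => hS j (Finset.mem_insert_of_mem hj))
      (fun j hj => hfin j (Finset.mem_insert_of_mem hj))
      (hd.subset (by simp))
    have hdis : Disjoint (S i) (⋃ j ∈ s, S j) := by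
      rw [disjoint_iUnion₂_right]
      intro j hj
      exact hd (by simp) (by simp [hj]) (fun hij => hi (hij ▸ hj))
    have hm2 : MeasurableSet (⋃ j ∈ s, S j) :=
      Finset.measurableSet_biUnion s fun j hj => hS j (Finset.mem_insert_of_mem hj)
    have hfin2 : m (S i ∪ ⋃ j ∈ s, S j) < ∞ :=
      measure_union_lt_top (hfin i (Finset.mem_insert_self i s))
        (measure_biUnion_lt_top s.finite_toSet fun j hj => hfin j (Finset.mem_insert_of_mem hj))
    filter_upwards [ih', hM.ae_union (hS i (Finset.mem_insert_self i s)) hm2 hdis hfin2]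
      with ω h1 h2
    rw [Finset.set_biUnion_insert, Finset.sum_insert hi, h2, h1]

/-- The integral of a simple function of a simple function. -/
lemma ae_simpleIntegral_map (hM : IsSymmStableRandomMeasure α m M Pr) {γ : Type*} [Zero γ]
    (χ : SimpleFunc X γ) (hχ : χ.FinMeasSupp m) (g : γ → ℝ) (hg : g 0 = 0) :
    ∀ᵐ ω ∂Pr, simpleIntegral M (χ.map g) ω = ∑ c ∈ χ.range, g c * M (χ ⁻¹' {c}) ω := by
  classical
  have key : ∀ᵐ ω ∂Pr, ∀ i ∈ (χ.range : Set γ), g i * M ((χ.map g) ⁻¹' {g i}) ω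
      = ∑ j ∈ χ.range with g j = g i, g j * M (χ ⁻¹' {j}) ω := by
    rw [ae_ball_iff χ.range.countable_toSet]
    intro i _
    -- The fibre over 0 may have infinite control measure, where M is unconstrained; its coefficient
    -- 0 removes it.
    rcases eq_or_ne (g i) 0 with h0 | h0
    · refine ae_of_all _ fun ω => ?_
      rw [h0, zero_mul]
      refine (Finset.sum_eq_zero fun j hj => ?_).symm
      rw [(Finset.mem_filter.1 hj).2, zero_mul]
    · have hu : (χ.map g) ⁻¹' {g i} = ⋃ j ∈ χ.range.filter (fun j => g j = g i), χ ⁻¹' {j} := by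
        rw [SimpleFunc.map_preimage_singleton]
        ext x
        simp
      have hne : ∀ j ∈ χ.range.filter (fun j => g j = g i), j ≠ 0 := by
        rintro j hj rfl
        exact h0 ((Finset.mem_filter.1 hj).2 ▸ hg)
      have := hM.ae_biUnion (χ.range.filter (fun j => g j = g i)) (fun j => χ ⁻¹' {j})
        (fun j _ => χ.measurableSet_fiber j)
        (fun j hj => hχ.meas_preimage_singleton_ne_zero (hne j hj))
        (fun a _ b _ hab => disjoint_singleton.2 hab |>.preimage χ)
      filter_upwards [this] with ω hω
      rw [hu, hω, Finset.mul_sum]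
      refine Finset.sum_congr rfl fun j hj => ?_
      rw [(Finset.mem_filter.1 hj).2]
  filter_upwards [key] with ω hω
  rw [simpleIntegral, SimpleFunc.range_map]
  exact Finset.sum_image' _ fun i hi => hω i hi

/-- Both functions are read on the common refinement given by their pair. Exceptional null sets
arise because M is additive only almost surely. -/
lemma ae_simpleIntegral_add (hM : IsSymmStableRandomMeasure α m M Pr) {φ ψ : SimpleFunc X ℝ}
    (hφ : φ.FinMeasSupp m) (hψ : ψ.FinMeasSupp m) :
    ∀ᵐ ω ∂Pr, simpleIntegral M (φ + ψ) ω = simpleIntegral M φ ω + simpleIntegral M ψ ω := by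
  have hp := hφ.pair hψ
  filter_upwards [hM.ae_simpleIntegral_map _ hp (fun p => p.1 + p.2) (by simp),
    hM.ae_simpleIntegral_map _ hp Prod.fst rfl, hM.ae_simpleIntegral_map _ hp Prod.snd rfl]
    with ω h1 h2 h3
  rw [SimpleFunc.map_fst_pair] at h2
  rw [SimpleFunc.map_snd_pair] at h3
  rw [SimpleFunc.add_eq_map₂, h1, h2, h3, ← Finset.sum_add_distrib]
  exact Finset.sum_congr rfl fun c _ => add_mul _ _ _

lemma ae_simpleIntegral_smul (hM : IsSymmStableRandomMeasure α m M Pr) (a : ℝ)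
    {φ : SimpleFunc X ℝ} (hφ : φ.FinMeasSupp m) :
    ∀ᵐ ω ∂Pr, simpleIntegral M (a • φ) ω = a * simpleIntegral M φ ω := by
  filter_upwards [hM.ae_simpleIntegral_map φ hφ (fun c => a • c) (by simp)] with ω h1
  rw [SimpleFunc.smul_eq_map, h1, simpleIntegral, Finset.mul_sum]
  exact Finset.sum_congr rfl fun c _ => by rw [smul_eq_mul, mul_assoc]

lemma aemeasurable_simpleIntegral (hM : IsSymmStableRandomMeasure α m M Pr)
    {φ : SimpleFunc X ℝ} (hφ : φ.FinMeasSupp m) : AEMeasurable (simpleIntegral M φ) Pr := by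
  unfold simpleIntegral
  refine Finset.aemeasurable_fun_sum _ fun c _ => ?_
  rcases eq_or_ne c 0 with rfl | hc
  · simp only [zero_mul]
    exact aemeasurable_const
  · exact (hM.aemeasurable _ (φ.measurableSet_fiber c)
      (hφ.meas_preimage_singleton_ne_zero hc)).const_mul c

lemma toReal_alphaEnergy_simpleFunc (hα : 0 < α) {φ : SimpleFunc X ℝ} (hφ : φ.FinMeasSupp m) :
    (alphaEnergy α m φ).toReal = ∑ c ∈ φ.range.erase 0, |c| ^ α * (m (φ ⁻¹' {c})).toReal := by
  have h1 : alphaEnergy α m φ = ∑ c ∈ φ.range, ‖c‖ₑ ^ α * m (φ ⁻¹' {c}) := by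
    rw [← SimpleFunc.map_lintegral, ← SimpleFunc.lintegral_eq_lintegral]
    rfl
  rw [h1, ← Finset.sum_erase (a := (0 : ℝ)) _ (by simp [ENNReal.zero_rpow_of_pos hα]),
    ENNReal.toReal_sum]
  · refine Finset.sum_congr rfl fun c _ => ?_
    rw [ENNReal.toReal_mul, ← ENNReal.toReal_rpow, toReal_enorm, Real.norm_eq_abs]
  · intro c hc
    exact ENNReal.mul_ne_top (ENNReal.rpow_ne_top_of_nonneg hα.le enorm_ne_top)
      (hφ.meas_preimage_singleton_ne_zero (Finset.ne_of_mem_erase hc)).ne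

/-- The fibres over nonzero values are disjoint of finite control measure, so their contributions
are independent and the exponents add up to the energy. -/
lemma charFun_simpleIntegral [IsProbabilityMeasure Pr]
    (hM : IsSymmStableRandomMeasure α m M Pr) (hα : 0 < α) {φ : SimpleFunc X ℝ}
    (hφ : φ.FinMeasSupp m) (θ : ℝ) :
    charFun (Pr.map (simpleIntegral M φ)) θ
      = Complex.exp ((-((alphaEnergy α m φ).toReal * |θ| ^ α) : ℝ) : ℂ) := by
  set T := φ.range.erase 0 with hT
  have hne : ∀ c ∈ T, c ≠ 0 := fun c hc => Finset.ne_of_mem_erase hc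
  have hfin : ∀ c ∈ T, m (φ ⁻¹' {c}) < ∞ := fun c hc =>
    hφ.meas_preimage_singleton_ne_zero (hne c hc)
  have hsum : simpleIntegral M φ = fun ω => ∑ c ∈ T, c * M (φ ⁻¹' {c}) ω := by
    ext ω
    rw [simpleIntegral, hT, Finset.sum_erase _ (by simp)]
  have haem : ∀ c ∈ T, AEMeasurable (fun ω => c * M (φ ⁻¹' {c}) ω) Pr := fun c hc =>
    (hM.aemeasurable _ (φ.measurableSet_fiber c) (hfin c hc)).const_mul c
  have hind : iIndepFun (T.restrict fun c ω => c * M (φ ⁻¹' {c}) ω) Pr := by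
    have h1 := hM.indep T.card (fun i => φ ⁻¹' {(T.equivFin.symm i : ℝ)})
      (fun i => φ.measurableSet_fiber _) (fun i => hfin _ (T.equivFin.symm i).2)
      (fun i j hij => (disjoint_singleton.2 fun h =>
        hij (T.equivFin.symm.injective (Subtype.ext h))).preimage φ)
    have h2 := h1.precomp T.equivFin.injective
    simp only [Equiv.symm_apply_apply] at h2
    exact h2.comp (fun (c : T) x => (c : ℝ) * x) fun c => measurable_const_mul _
  rw [hsum, hind.charFun_map_fun_finsetSum_eq_prod haem, Finset.prod_apply,
    toReal_alphaEnergy_simpleFunc hα hφ, Finset.sum_mul, ← Finset.sum_neg_distrib,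
    Complex.ofReal_sum, Complex.exp_sum]
  refine Finset.prod_congr rfl fun c hc => ?_
  rw [charFun_map_eq (haem c hc)]
  have h3 := hM.charFun_eq _ (φ.measurableSet_fiber c) (hfin c hc) (θ * c)
  simp_rw [mul_assoc] at h3
  rw [h3, abs_mul, Real.mul_rpow (abs_nonneg _) (abs_nonneg _)]
  congr 2
  ring

end IsSymmStableRandomMeasure

/-- The tail of a symmetric stable random variable in terms of its scale. -/
lemma measureReal_abs_gt_le_of_charFun [IsProbabilityMeasure Pr] (hα : 0 < α) {Y : Ω → ℝ}
    (hY : AEMeasurable Y Pr) {c : ℝ} (hc : 0 ≤ c)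
    (hch : ∀ θ : ℝ, charFun (Pr.map Y) θ = Complex.exp ((-(c * |θ| ^ α) : ℝ) : ℂ)) {r : ℝ}
    (hr : 0 < r) : Pr.real {ω | r < |Y ω|} ≤ 2 * (c * (2 * r⁻¹) ^ α) := by
  have : IsProbabilityMeasure (Pr.map Y) := Measure.isProbabilityMeasure_map hY
  -- The tail is at most r/2 times the integral of 1 - charFun over [-2/r, 2/r]. The interval has
  -- length 4/r and 1 - e^{-u} ≤ u, whence the factor 2.
  have h1 := measureReal_abs_gt_le_integral_charFun (μ := Pr.map Y) hr
  have hset : MeasurableSet {x : ℝ | r < |x|} := measurableSet_lt measurable_const (by fun_prop)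
  rw [measureReal_def, Measure.map_apply_of_aemeasurable hY hset] at h1
  refine h1.trans ?_
  have h2 : ‖∫ t in (-2 * r⁻¹)..(2 * r⁻¹), 1 - charFun (Pr.map Y) t‖
      ≤ (c * (2 * r⁻¹) ^ α) * |2 * r⁻¹ - -2 * r⁻¹| := by
    refine intervalIntegral.norm_integral_le_of_norm_le_const fun t ht => ?_
    rw [uIoc_of_le (by have := inv_pos.2 hr; linarith)] at ht
    have htabs : |t| ≤ 2 * r⁻¹ := abs_le.2 ⟨by linarith [ht.1], ht.2⟩
    rw [hch, ← Complex.ofReal_exp, ← Complex.ofReal_one, ← Complex.ofReal_sub, Complex.norm_real]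
    have h3 : 0 ≤ c * |t| ^ α := by positivity
    have h4 : Real.exp (-(c * |t| ^ α)) ≤ 1 := Real.exp_le_one_iff.2 (by linarith)
    rw [Real.norm_of_nonneg (by linarith)]
    have h5 := Real.add_one_le_exp (-(c * |t| ^ α))
    have h6 : c * |t| ^ α ≤ c * (2 * r⁻¹) ^ α :=
      mul_le_mul_of_nonneg_left (Real.rpow_le_rpow (abs_nonneg _) htabs hα.le) hc
    linarith
  have h7 : |2 * r⁻¹ - -2 * r⁻¹| = 4 * r⁻¹ := by
    rw [abs_of_pos (by have := inv_pos.2 hr; linarith)]; ring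
  rw [h7] at h2
  calc 2⁻¹ * r * ‖∫ t in (-2 * r⁻¹)..(2 * r⁻¹), 1 - charFun (Pr.map Y) t‖
      ≤ 2⁻¹ * r * ((c * (2 * r⁻¹) ^ α) * (4 * r⁻¹)) :=
        mul_le_mul_of_nonneg_left h2 (by positivity)
    _ = 2 * (c * (2 * r⁻¹) ^ α) * (r * r⁻¹) := by ring
    _ = _ := by rw [mul_inv_cancel₀ hr.ne', mul_one]

end StableMeasure

/-! ### Convergence in L^α, including α < 1 -/

section Energy

variable {X : Type*} [MeasurableSpace X] {α : ℝ} {m : Measure X}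

lemma eLpNorm_rpow_eq_alphaEnergy (hα : 0 < α) (g : X → ℝ) :
    eLpNorm g (ENNReal.ofReal α) m ^ α = alphaEnergy α m g := by
  rw [eLpNorm_eq_lintegral_rpow_enorm_toReal (by simpa using hα) ENNReal.ofReal_ne_top,
    ENNReal.toReal_ofReal hα.le, ← ENNReal.rpow_mul, one_div, inv_mul_cancel₀ hα.ne',
    ENNReal.rpow_one, alphaEnergy]

lemma alphaEnergy_rpow_eq_eLpNorm (hα : 0 < α) (g : X → ℝ) :
    alphaEnergy α m g ^ α⁻¹ = eLpNorm g (ENNReal.ofReal α) m := by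
  rw [← eLpNorm_rpow_eq_alphaEnergy hα, ← ENNReal.rpow_mul, mul_inv_cancel₀ hα.ne',
    ENNReal.rpow_one]

lemma tendsto_alphaEnergy_zero_iff (hα : 0 < α) {ι : Type*} {l : Filter ι} {f : ι → X → ℝ} :
    Tendsto (fun n => alphaEnergy α m (f n)) l (𝓝 0)
      ↔ Tendsto (fun n => eLpNorm (f n) (ENNReal.ofReal α) m) l (𝓝 0) := by
  constructor
  · intro h
    have := ((ENNReal.continuous_rpow_const (y := α⁻¹)).tendsto 0).comp h
    rw [ENNReal.zero_rpow_of_pos (inv_pos.2 hα)] at this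
    exact this.congr fun n => alphaEnergy_rpow_eq_eLpNorm hα _
  · intro h
    have := ((ENNReal.continuous_rpow_const (y := α)).tendsto 0).comp h
    rw [ENNReal.zero_rpow_of_pos hα] at this
    exact this.congr fun n => eLpNorm_rpow_eq_alphaEnergy hα _

/-- If a ≤ b then (a + b)^α ≤ (2b)^α ≤ 4b^α, as α ≤ 2. This crude inequality replaces the triangle
inequality uniformly in α, also below 1. -/
lemma alphaEnergy_add_le (hα : 0 < α) (hα2 : α ≤ 2) {f g : X → ℝ}
    (hf : AEStronglyMeasurable f m) :
    alphaEnergy α m (fun x => f x + g x) ≤ 4 * (alphaEnergy α m f + alphaEnergy α m g) := by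
  have hpt : ∀ a b : ℝ≥0∞, (a + b) ^ α ≤ 4 * (a ^ α + b ^ α) := by
    have h4 : (2 : ℝ≥0∞) ^ α ≤ 4 := by
      calc (2 : ℝ≥0∞) ^ α ≤ 2 ^ (2 : ℝ) :=
            ENNReal.rpow_le_rpow_of_exponent_le (by norm_num) hα2
        _ = 4 := by rw [ENNReal.rpow_two]; norm_num
    have haux : ∀ a b : ℝ≥0∞, a ≤ b → (a + b) ^ α ≤ 4 * (a ^ α + b ^ α) := by
      intro a b hab
      calc (a + b) ^ α ≤ (2 * b) ^ α :=
            ENNReal.rpow_le_rpow (by rw [two_mul]; gcongr) hα.le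
        _ = 2 ^ α * b ^ α := ENNReal.mul_rpow_of_nonneg _ _ hα.le
        _ ≤ 4 * (a ^ α + b ^ α) := mul_le_mul' h4 le_add_self
    intro a b
    rcases le_total a b with h | h
    · exact haux a b h
    · rw [add_comm, add_comm (a ^ α)]
      exact haux b a h
  rw [alphaEnergy, alphaEnergy, alphaEnergy, ← lintegral_add_left' (hf.enorm.pow_const α),
    ← lintegral_const_mul' _ _ (by norm_num)]
  exact lintegral_mono fun x =>
    (ENNReal.rpow_le_rpow (enorm_add_le (f x) (g x)) hα.le).trans (hpt _ _)

lemma alphaEnergy_const_mul (hα : 0 ≤ α) (a : ℝ) (f : X → ℝ) :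
    alphaEnergy α m (fun x => a * f x) = ‖a‖ₑ ^ α * alphaEnergy α m f := by
  rw [alphaEnergy, alphaEnergy, ← lintegral_const_mul' _ _
    (ENNReal.rpow_ne_top_of_nonneg hα enorm_ne_top)]
  refine lintegral_congr fun x => ?_
  rw [enorm_mul, ENNReal.mul_rpow_of_nonneg _ _ hα]

lemma alphaEnergy_neg (f : X → ℝ) : alphaEnergy α m (fun x => -f x) = alphaEnergy α m f := by
  simp [alphaEnergy]

lemma alphaEnergy_sub_comm (f g : X → ℝ) :
    alphaEnergy α m (fun x => f x - g x) = alphaEnergy α m (fun x => g x - f x) := by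
  rw [← alphaEnergy_neg]
  simp

lemma tendsto_of_le_add {ι : Type*} {l : Filter ι} {a : ℝ≥0∞} (ha : a ≠ ∞) {u e : ι → ℝ≥0∞}
    (he : Tendsto e l (𝓝 0)) (h1 : ∀ n, u n ≤ a + e n) (h2 : ∀ n, a ≤ u n + e n) :
    Tendsto u l (𝓝 a) := by
  have hlo : Tendsto (fun n => a - e n) l (𝓝 a) := by
    simpa using ENNReal.Tendsto.sub (tendsto_const_nhds (x := a)) he (Or.inl ha)
  have hhi : Tendsto (fun n => a + e n) l (𝓝 a) := by
    simpa using (tendsto_const_nhds (x := a)).add he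
  exact tendsto_of_tendsto_of_tendsto_of_le_of_le hlo hhi
    (fun n => tsub_le_iff_right.2 (h2 n)) h1

/-- For α ≤ 1 the energy itself satisfies the triangle inequality; for α ≥ 1 its power 1/α, the
norm, does. -/
lemma tendsto_alphaEnergy (hα : 0 < α) {ι : Type*} {l : Filter ι} {f : ι → X → ℝ} {g : X → ℝ}
    (hf : ∀ n, AEStronglyMeasurable (f n) m) (hg : AEStronglyMeasurable g m)
    (hfin : alphaEnergy α m g ≠ ∞)
    (h : Tendsto (fun n => alphaEnergy α m (fun x => f n x - g x)) l (𝓝 0)) :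
    Tendsto (fun n => alphaEnergy α m (f n)) l (𝓝 (alphaEnergy α m g)) := by
  rcases le_total α 1 with h1 | h1
  · have hsub : ∀ u v : X → ℝ, AEStronglyMeasurable v m →
        alphaEnergy α m u ≤ alphaEnergy α m v + alphaEnergy α m (fun x => u x - v x) := by
      intro u v hv
      rw [alphaEnergy, alphaEnergy, alphaEnergy, ← lintegral_add_left' (hv.enorm.pow_const α)]
      refine lintegral_mono fun x => ?_
      calc ‖u x‖ₑ ^ α = ‖v x + (u x - v x)‖ₑ ^ α := by rw [add_sub_cancel]
        _ ≤ (‖v x‖ₑ + ‖u x - v x‖ₑ) ^ α := ENNReal.rpow_le_rpow (enorm_add_le _ _) hα.le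
        _ ≤ _ := ENNReal.rpow_add_le_add_rpow _ _ hα.le h1
    refine tendsto_of_le_add hfin h (fun n => hsub _ _ hg) fun n => ?_
    rw [alphaEnergy_sub_comm]
    exact hsub _ _ (hf n)
  · have hp : 1 ≤ ENNReal.ofReal α := by simpa using h1
    have hsub : ∀ u v : X → ℝ, AEStronglyMeasurable u m → AEStronglyMeasurable v m →
        eLpNorm u (ENNReal.ofReal α) m ≤ eLpNorm v (ENNReal.ofReal α) m
          + eLpNorm (fun x => u x - v x) (ENNReal.ofReal α) m := by
      intro u v hu hv
      have := eLpNorm_add_le hv (hu.sub hv) hp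
      rwa [add_sub_cancel] at this
    have hgfin : eLpNorm g (ENNReal.ofReal α) m ≠ ∞ := by
      rw [← alphaEnergy_rpow_eq_eLpNorm hα]
      exact ENNReal.rpow_ne_top_of_nonneg (inv_nonneg.2 hα.le) hfin
    have hlim := tendsto_of_le_add hgfin ((tendsto_alphaEnergy_zero_iff hα).1 h)
      (fun n => hsub _ _ (hf n) hg) (fun n => by
        have := hsub g (f n) hg (hf n)
        rw [show (fun x => g x - f n x) = g - f n from rfl, eLpNorm_sub_comm g (f n)] at this
        exact this)
    have := ((ENNReal.continuous_rpow_const (y := α)).tendsto _).comp hlim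
    rw [eLpNorm_rpow_eq_alphaEnergy hα] at this
    exact this.congr fun n => eLpNorm_rpow_eq_alphaEnergy hα _

lemma memLp_iff_alphaEnergy (hα : 0 < α) {g : X → ℝ} (hg : AEStronglyMeasurable g m) :
    MemLp g (ENNReal.ofReal α) m ↔ alphaEnergy α m g ≠ ∞ := by
  rw [← eLpNorm_rpow_eq_alphaEnergy hα, MemLp, and_iff_right hg, lt_top_iff_ne_top,
    not_iff_not, ENNReal.rpow_eq_top_iff_of_pos hα]

lemma toReal_alphaEnergy (hα : 0 ≤ α) {g : X → ℝ} (hg : AEStronglyMeasurable g m) :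
    (alphaEnergy α m g).toReal = ∫ x, |g x| ^ α ∂m := by
  have hm : AEStronglyMeasurable (fun x => |g x| ^ α) m :=
    (hg.norm.aemeasurable.pow_const α).aestronglyMeasurable
  rw [integral_eq_lintegral_of_nonneg_ae (ae_of_all _ fun x => by positivity) hm, alphaEnergy]
  congr 1
  refine lintegral_congr fun x => ?_
  rw [← ENNReal.ofReal_rpow_of_nonneg (abs_nonneg _) hα, Real.enorm_eq_ofReal_abs]

end Energy

/-! ### The stochastic integral: linearity, law, uniqueness, existence -/

section StochasticIntegral

variable {Ω X : Type*} [MeasurableSpace Ω] [MeasurableSpace X] {α : ℝ} {m : Measure X}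
  {M : Set X → Ω → ℝ} {Pr : Measure Ω}

/-- A subsequence converges almost surely and still approximates in L^α, so convergence in
probability can be traded for almost sure convergence. -/
lemma isStochasticIntegral_iff [IsProbabilityMeasure Pr]
    (hM : IsSymmStableRandomMeasure α m M Pr) (hα : 0 < α) {g : X → ℝ} {I : Ω → ℝ} :
    IsStochasticIntegral α m M Pr g I ↔ AEMeasurable I Pr ∧ ∃ φ : ℕ → SimpleFunc X ℝ,
      (∀ n, (φ n).FinMeasSupp m) ∧
      Tendsto (fun n => alphaEnergy α m (fun p => φ n p - g p)) atTop (𝓝 0) ∧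
      ∀ᵐ ω ∂Pr, Tendsto (fun n => simpleIntegral M (φ n) ω) atTop (𝓝 (I ω)) := by
  constructor
  · rintro ⟨hI, φ, hφ, hE, hlim⟩
    obtain ⟨ns, hns, hae⟩ := hlim.exists_seq_tendsto_ae
    exact ⟨hI, fun n => φ (ns n), fun n => hφ _,
      ((tendsto_alphaEnergy_zero_iff hα).2 hE).comp hns.tendsto_atTop, hae⟩
  · rintro ⟨hI, φ, hφ, hE, hlim⟩
    exact ⟨hI, φ, hφ, (tendsto_alphaEnergy_zero_iff hα).1 hE, tendstoInMeasure_of_tendsto_ae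
      (fun n => (hM.aemeasurable_simpleIntegral (hφ n)).aestronglyMeasurable) hlim⟩

namespace IsStochasticIntegral

variable [IsProbabilityMeasure Pr] {g g' : X → ℝ} {I I' : Ω → ℝ}

lemma add (hM : IsSymmStableRandomMeasure α m M Pr) (hα : 0 < α) (hα2 : α ≤ 2)
    (hg : AEStronglyMeasurable g m) (h : IsStochasticIntegral α m M Pr g I)
    (h' : IsStochasticIntegral α m M Pr g' I') :
    IsStochasticIntegral α m M Pr (fun x => g x + g' x) (fun ω => I ω + I' ω) := by
  rw [isStochasticIntegral_iff hM hα] at h h' ⊢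
  obtain ⟨hI, φ, hφ, hE, hlim⟩ := h
  obtain ⟨hI', φ', hφ', hE', hlim'⟩ := h'
  refine ⟨hI.add hI', fun n => φ n + φ' n, fun n => (hφ n).add (hφ' n), ?_, ?_⟩
  · have hz : Tendsto (fun n => 4 * (alphaEnergy α m (fun p => φ n p - g p)
        + alphaEnergy α m (fun p => φ' n p - g' p))) atTop (𝓝 0) := by
      have := ENNReal.Tendsto.const_mul (a := 4) (hE.add hE') (Or.inr (by norm_num))
      simpa using this
    refine tendsto_of_tendsto_of_tendsto_of_le_of_le tendsto_const_nhds hz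
      (fun _ => zero_le) fun n => ?_
    have := alphaEnergy_add_le hα hα2 (f := fun p => φ n p - g p) (g := fun p => φ' n p - g' p)
      ((φ n).aestronglyMeasurable.sub hg)
    refine le_trans (le_of_eq ?_) this
    congr 1
    ext p
    simp only [SimpleFunc.coe_add, Pi.add_apply]
    ring
  · have hs : ∀ᵐ ω ∂Pr, ∀ n, simpleIntegral M (φ n + φ' n) ω
        = simpleIntegral M (φ n) ω + simpleIntegral M (φ' n) ω :=
      ae_all_iff.2 fun n => hM.ae_simpleIntegral_add (hφ n) (hφ' n)
    filter_upwards [hlim, hlim', hs] with ω h1 h2 h3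
    simp_rw [h3]
    exact h1.add h2

lemma const_mul (hM : IsSymmStableRandomMeasure α m M Pr) (hα : 0 < α) (a : ℝ)
    (h : IsStochasticIntegral α m M Pr g I) :
    IsStochasticIntegral α m M Pr (fun x => a * g x) (fun ω => a * I ω) := by
  rw [isStochasticIntegral_iff hM hα] at h ⊢
  obtain ⟨hI, φ, hφ, hE, hlim⟩ := h
  refine ⟨hI.const_mul a, fun n => a • φ n, fun n => (hφ n).map (smul_zero a), ?_, ?_⟩
  · have hz := ENNReal.Tendsto.const_mul (a := ‖a‖ₑ ^ α) hE
      (Or.inr (ENNReal.rpow_ne_top_of_nonneg hα.le enorm_ne_top))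
    rw [mul_zero] at hz
    refine hz.congr fun n => ?_
    rw [← alphaEnergy_const_mul hα.le]
    congr 1
    ext p
    simp [mul_sub]
  · have hs : ∀ᵐ ω ∂Pr, ∀ n, simpleIntegral M (a • φ n) ω = a * simpleIntegral M (φ n) ω :=
      ae_all_iff.2 fun n => hM.ae_simpleIntegral_smul a (hφ n)
    filter_upwards [hlim, hs] with ω h1 h3
    simp_rw [h3]
    exact h1.const_mul a

lemma zero (hM : IsSymmStableRandomMeasure α m M Pr) (hα : 0 < α) :
    IsStochasticIntegral α m M Pr (fun _ => 0) (fun _ => 0) := by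
  rw [isStochasticIntegral_iff hM hα]
  refine ⟨aemeasurable_const, fun _ => 0, fun _ => by simp [SimpleFunc.finMeasSupp_iff_support],
    ?_, ae_of_all _ fun ω => ?_⟩
  · simp [alphaEnergy, hα]
  · have : simpleIntegral M (0 : SimpleFunc X ℝ) ω = 0 := by
      unfold simpleIntegral
      refine Finset.sum_eq_zero fun c hc => ?_
      obtain ⟨x, rfl⟩ := SimpleFunc.mem_range.1 hc
      simp
    simp [this]

lemma finset_sum (hM : IsSymmStableRandomMeasure α m M Pr) (hα : 0 < α) (hα2 : α ≤ 2)
    {T : Type*} (s : Finset T) (a : T → ℝ) {g : T → X → ℝ} {I : T → Ω → ℝ}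
    (hg : ∀ t, AEStronglyMeasurable (g t) m)
    (h : ∀ t, IsStochasticIntegral α m M Pr (g t) (I t)) :
    IsStochasticIntegral α m M Pr (fun x => ∑ t ∈ s, a t * g t x)
      (fun ω => ∑ t ∈ s, a t * I t ω) := by
  classical
  induction s using Finset.induction_on with
  | empty => simpa using zero hM hα
  | insert t s ht ih =>
    simp_rw [Finset.sum_insert ht]
    exact add hM hα hα2 ((hg t).const_mul (a t)) (const_mul hM hα (a t) (h t)) ih

/-- The stochastic integral of `g` is symmetric stable with scale `∫ |g| ^ α`. -/
lemma charFun_eq (hM : IsSymmStableRandomMeasure α m M Pr) (hα : 0 < α)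
    (hg : AEStronglyMeasurable g m) (hfin : alphaEnergy α m g ≠ ∞)
    (h : IsStochasticIntegral α m M Pr g I) (θ : ℝ) :
    charFun (Pr.map I) θ
      = Complex.exp ((-((alphaEnergy α m g).toReal * |θ| ^ α) : ℝ) : ℂ) := by
  rw [isStochasticIntegral_iff hM hα] at h
  obtain ⟨hI, φ, hφ, hE, hlim⟩ := h
  have hEn := (ENNReal.tendsto_toReal hfin).comp
    (tendsto_alphaEnergy hα (fun n => (φ n).aestronglyMeasurable) hg hfin hE)
  -- The same sequence has two limits: one from convergence of the energies, one from bounded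
  -- convergence along the almost sure limit.
  have h1 : Tendsto (fun n => charFun (Pr.map (simpleIntegral M (φ n))) θ) atTop
      (𝓝 (Complex.exp ((-((alphaEnergy α m g).toReal * |θ| ^ α) : ℝ) : ℂ))) := by
    simp_rw [fun n => hM.charFun_simpleIntegral hα (hφ n) θ]
    exact (Complex.continuous_exp.tendsto _).comp
      ((Complex.continuous_ofReal.tendsto _).comp ((hEn.mul_const _).neg))
  have h2 : Tendsto (fun n => charFun (Pr.map (simpleIntegral M (φ n))) θ) atTop
      (𝓝 (charFun (Pr.map I) θ)) := by
    rw [charFun_map_eq hI]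
    simp_rw [fun n => charFun_map_eq (hM.aemeasurable_simpleIntegral (hφ n)) θ]
    refine tendsto_integral_of_dominated_convergence (fun _ => 1) (fun n => ?_)
      (integrable_const _) (fun n => ae_of_all _ fun ω => ?_) ?_
    · have := hM.aemeasurable_simpleIntegral (hφ n)
      have hc : Continuous fun y : ℝ => Complex.exp (Complex.I * ((θ * y : ℝ) : ℂ)) := by fun_prop
      exact (hc.measurable.comp_aemeasurable this).aestronglyMeasurable
    · rw [mul_comm, Complex.norm_exp_ofReal_mul_I]
    · filter_upwards [hlim] with ω hω
      have hc : Continuous fun y : ℝ => Complex.exp (Complex.I * ((θ * y : ℝ) : ℂ)) := by fun_prop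
      exact (hc.tendsto _).comp hω
  exact tendsto_nhds_unique h2 h1

/-- The difference of two versions is an integral of 0, so it has scale 0 and the tail bound makes
every tail vanish. -/
lemma ae_unique (hM : IsSymmStableRandomMeasure α m M Pr) (hα : 0 < α) (hα2 : α ≤ 2)
    (hg : AEStronglyMeasurable g m) (h : IsStochasticIntegral α m M Pr g I)
    (h' : IsStochasticIntegral α m M Pr g I') : I =ᵐ[Pr] I' := by
  have hsub := add hM hα hα2 hg h (const_mul hM hα (-1) h')
  have hz : (fun x => g x + -1 * g x) = fun _ => (0 : ℝ) := by ext x; ring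
  rw [hz] at hsub
  have hE : alphaEnergy α m (fun _ : X => (0 : ℝ)) = 0 := by simp [alphaEnergy, hα]
  have hch := charFun_eq hM hα aestronglyMeasurable_const (by rw [hE]; exact ENNReal.zero_ne_top)
    hsub
  have htail : ∀ n : ℕ, Pr {ω | 1 / ((n : ℝ) + 1) < |I ω + -1 * I' ω|} = 0 := by
    intro n
    have := measureReal_abs_gt_le_of_charFun hα hsub.1 ENNReal.toReal_nonneg hch
      (r := 1 / ((n : ℝ) + 1)) (by positivity)
    rw [hE] at this
    simp only [ENNReal.toReal_zero, zero_mul, mul_zero] at this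
    exact (measureReal_eq_zero_iff).1 (le_antisymm this measureReal_nonneg)
  have hall : ∀ᵐ ω ∂Pr, ∀ n : ℕ, ¬ 1 / ((n : ℝ) + 1) < |I ω + -1 * I' ω| :=
    ae_all_iff.2 fun n => by
      rw [ae_iff]
      simpa using htail n
  filter_upwards [hall] with ω hω
  by_contra hne
  obtain ⟨n, hn⟩ := exists_nat_one_div_lt (abs_pos.2 (sub_ne_zero.2 hne))
  refine hω n (hn.trans_le (le_of_eq ?_))
  congr 1
  ring

end IsStochasticIntegral

lemma exists_isStochasticIntegral [IsProbabilityMeasure Pr]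
    (hM : IsSymmStableRandomMeasure α m M Pr) (hα : 0 < α) (hα2 : α ≤ 2) {g : X → ℝ}
    (hg : MemLp g (ENNReal.ofReal α) m) : ∃ I, IsStochasticIntegral α m M Pr g I := by
  have hp0 : ENNReal.ofReal α ≠ 0 := by simpa using hα
  -- fast approximation in `L^α`
  have happrox : ∀ n : ℕ, ∃ φ : SimpleFunc X ℝ, φ.FinMeasSupp m ∧
      alphaEnergy α m (fun p => φ p - g p) ≤ ENNReal.ofReal ((1 / 16) ^ n) := by
    intro n
    have hpos : (0 : ℝ) < (1 / 16) ^ n := by positivity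
    obtain ⟨φ, hφ, hφL⟩ := hg.exists_simpleFunc_eLpNorm_sub_lt ENNReal.ofReal_ne_top
      (ε := ENNReal.ofReal ((1 / 16) ^ n) ^ α⁻¹)
      (by
        refine (ENNReal.rpow_pos ?_ ENNReal.ofReal_ne_top).ne'
        exact ENNReal.ofReal_pos.2 hpos)
    refine ⟨φ, (SimpleFunc.memLp_iff_finMeasSupp hp0 ENNReal.ofReal_ne_top).1 hφL, ?_⟩
    rw [alphaEnergy_sub_comm, ← eLpNorm_rpow_eq_alphaEnergy hα]
    refine (ENNReal.rpow_le_rpow hφ.le hα.le).trans (le_of_eq ?_)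
    rw [← ENNReal.rpow_mul, inv_mul_cancel₀ hα.ne', ENNReal.rpow_one]
  choose φ hφ hE using happrox
  have hE0 : Tendsto (fun n => alphaEnergy α m (fun p => φ n p - g p)) atTop (𝓝 0) := by
    refine tendsto_of_tendsto_of_tendsto_of_le_of_le tendsto_const_nhds ?_
      (fun _ => zero_le) hE
    have := (ENNReal.continuous_ofReal.tendsto 0).comp
      (tendsto_pow_atTop_nhds_zero_of_lt_one (r := (1 / 16 : ℝ)) (by norm_num) (by norm_num))
    rwa [ENNReal.ofReal_zero] at this
  -- the increments
  set Y : ℕ → Ω → ℝ := fun n => simpleIntegral M (φ (n + 1) + (-1 : ℝ) • φ n) with hY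
  have hYsupp : ∀ n, (φ (n + 1) + (-1 : ℝ) • φ n).FinMeasSupp m := fun n =>
    (hφ (n + 1)).add ((hφ n).map (smul_zero _))
  -- Both approximants are within 16^{-n} of g in energy; the quasi-triangle constant 4 gives 4(1 +
  -- 1) = 8.
  have hYE : ∀ n, (alphaEnergy α m (φ (n + 1) + (-1 : ℝ) • φ n : SimpleFunc X ℝ)).toReal
      ≤ 8 * (1 / 16) ^ n := by
    intro n
    have h1 : alphaEnergy α m (φ (n + 1) + (-1 : ℝ) • φ n : SimpleFunc X ℝ)
        ≤ ENNReal.ofReal (8 * (1 / 16) ^ n) := by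
      have h2 := alphaEnergy_add_le hα hα2 (f := fun p => φ (n + 1) p - g p)
        (g := fun p => g p - φ n p) ((φ (n + 1)).aestronglyMeasurable.sub hg.1)
      have h3 : (fun p => φ (n + 1) p - g p + (g p - φ n p))
          = (φ (n + 1) + (-1 : ℝ) • φ n : SimpleFunc X ℝ) := by
        ext p
        simp only [SimpleFunc.coe_add, SimpleFunc.coe_smul, Pi.add_apply, Pi.smul_apply,
          smul_eq_mul]
        ring
      rw [h3, alphaEnergy_sub_comm g] at h2
      have h4 : ENNReal.ofReal ((1 / 16) ^ (n + 1)) ≤ ENNReal.ofReal ((1 / 16) ^ n) :=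
        ENNReal.ofReal_le_ofReal (pow_le_pow_of_le_one (by norm_num) (by norm_num) n.le_succ)
      calc _ ≤ 4 * (ENNReal.ofReal ((1 / 16) ^ n) + ENNReal.ofReal ((1 / 16) ^ n)) :=
            h2.trans (mul_le_mul' le_rfl (add_le_add ((hE (n + 1)).trans h4) (hE n)))
        _ = _ := by
            rw [← two_mul, ← mul_assoc, ENNReal.ofReal_mul (by norm_num)]
            norm_num
    exact ENNReal.toReal_le_of_le_ofReal (by positivity) h1
  -- At level 2^{-n} the tail bound has the factor (2 · 2^n)^α ≤ 4 · 4^n. Against energy 8 · 16^{-n}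
  -- this leaves the summable 64 · 4^{-n}, which explains the rate 1/16; Borel–Cantelli then makes
  -- the increments eventually at most 2^{-n}.
  have htail : ∀ n : ℕ, Pr {ω | (1 / 2 : ℝ) ^ n < |Y n ω|}
      ≤ ENNReal.ofReal (64 * (1 / 4) ^ n) := by
    intro n
    have h1 := measureReal_abs_gt_le_of_charFun hα (hM.aemeasurable_simpleIntegral (hYsupp n))
      ENNReal.toReal_nonneg (hM.charFun_simpleIntegral hα (hYsupp n))
      (r := (1 / 2 : ℝ) ^ n) (by positivity)
    have h2 : (2 * ((1 / 2 : ℝ) ^ n)⁻¹) ^ α ≤ 4 * 4 ^ n := by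
      have hb : 2 * ((1 / 2 : ℝ) ^ n)⁻¹ = 2 ^ (n + 1) := by
        rw [← inv_pow, pow_succ]; norm_num; ring
      rw [hb]
      calc ((2 : ℝ) ^ (n + 1)) ^ α ≤ ((2 : ℝ) ^ (n + 1)) ^ (2 : ℝ) :=
            Real.rpow_le_rpow_of_exponent_le (one_le_pow₀ (by norm_num)) hα2
        _ = 4 * 4 ^ n := by
            rw [Real.rpow_two, ← pow_mul, mul_comm, pow_mul, pow_succ]; norm_num; ring
    rw [← ofReal_measureReal]
    refine ENNReal.ofReal_le_ofReal (h1.trans ?_)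
    calc _ ≤ 2 * ((8 * (1 / 16) ^ n) * (4 * 4 ^ n)) :=
          mul_le_mul_of_nonneg_left (mul_le_mul (hYE n) h2 (by positivity) (by positivity))
            zero_le_two
      _ = 64 * ((1 / 16) * 4) ^ n := by rw [mul_pow]; ring
      _ = _ := by norm_num
  have hBC : ∀ᵐ ω ∂Pr, ∀ᶠ n in atTop, ω ∉ {ω | (1 / 2 : ℝ) ^ n < |Y n ω|} := by
    refine ae_eventually_notMem (ne_top_of_le_ne_top ?_ (ENNReal.tsum_le_tsum htail))
    rw [← ENNReal.ofReal_tsum_of_nonneg (fun n => by positivity)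
      ((summable_geometric_of_lt_one (by norm_num) (by norm_num)).mul_left _)]
    exact ENNReal.ofReal_ne_top
  have hdiff : ∀ᵐ ω ∂Pr, ∀ n, Y n ω
      = simpleIntegral M (φ (n + 1)) ω - simpleIntegral M (φ n) ω := by
    refine ae_all_iff.2 fun n => ?_
    filter_upwards [hM.ae_simpleIntegral_add (hφ (n + 1)) ((hφ n).map (smul_zero (-1 : ℝ))),
      hM.ae_simpleIntegral_smul (-1) (hφ n)] with ω h1 h2
    rw [← SimpleFunc.smul_eq_map] at h1
    rw [hY]
    simp only
    rw [h1, h2]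
    ring
  have hconv : ∀ᵐ ω ∂Pr, ∃ l : ℝ, Tendsto (fun n => simpleIntegral M (φ n) ω) atTop (𝓝 l) := by
    filter_upwards [hBC, hdiff] with ω h1 h2
    refine cauchySeq_tendsto_of_complete (cauchySeq_of_summable_dist ?_)
    refine Summable.of_norm_bounded_eventually_nat
      (summable_geometric_of_lt_one (r := (1 / 2 : ℝ)) (by norm_num) (by norm_num)) ?_
    filter_upwards [h1] with n hn
    rw [Real.norm_of_nonneg dist_nonneg, dist_comm, Real.dist_eq, ← h2 n]
    exact not_lt.1 hn
  obtain ⟨I, hI, hlim⟩ := measurable_limit_of_tendsto_metrizable_ae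
    (fun n => hM.aemeasurable_simpleIntegral (hφ n)) hconv
  exact ⟨I, (isStochasticIntegral_iff hM hα).2 ⟨hI.aemeasurable, φ, hφ, hE0, hlim⟩⟩

lemma isStochasticIntegral_stochasticIntegral [IsProbabilityMeasure Pr]
    (hM : IsSymmStableRandomMeasure α m M Pr) (hα : 0 < α) (hα2 : α ≤ 2) {g : X → ℝ}
    (hg : MemLp g (ENNReal.ofReal α) m) :
    IsStochasticIntegral α m M Pr g (stochasticIntegral α m M Pr g) := by
  have h := exists_isStochasticIntegral hM hα hα2 hg
  rw [stochasticIntegral, dif_pos h]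
  exact h.choose_spec

end StochasticIntegral

lemma integral_add_sq {Z : Type*} [MeasurableSpace Z] {ν : Measure Z} {u v : Z → ℝ}
    (hu : MemLp u 2 ν) (hv : MemLp v 2 ν) : ∫ z, (u z + v z) ^ 2 ∂ν
      = ∫ z, u z ^ 2 ∂ν + 2 * ∫ z, u z * v z ∂ν + ∫ z, v z ^ 2 ∂ν := by
  have huv : Integrable (fun z => 2 * (u z * v z)) ν := (hu.integrable_mul hv).const_mul 2
  have huv2 : Integrable (fun z => u z ^ 2 + 2 * (u z * v z)) ν := hu.integrable_sq.add huv
  rw [← integral_const_mul, ← integral_add hu.integrable_sq huv,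
    ← integral_add huv2 hv.integrable_sq]
  refine integral_congr_ae (ae_of_all _ fun z => ?_)
  simp only
  ring

/-! ### Centred Gaussian laws -/

section GaussianLaw

variable {Ω : Type*} [MeasurableSpace Ω] {Pr : Measure Ω} [IsProbabilityMeasure Pr]
  {Y : Ω → ℝ} {c : ℝ}

/-- The stable normalization e^{-cθ²} lacks the Gaussian factor 1/2, so the variance is 2c. -/
lemma map_eq_gaussianReal_of_charFun (hY : AEMeasurable Y Pr) (hc : 0 ≤ c)
    (hch : ∀ θ : ℝ, charFun (Pr.map Y) θ
      = Complex.exp ((-(c * |θ| ^ (2 : ℝ)) : ℝ) : ℂ)) :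
    Pr.map Y = gaussianReal 0 (2 * c).toNNReal := by
  have : IsProbabilityMeasure (Pr.map Y) := Measure.isProbabilityMeasure_map hY
  refine Measure.ext_of_charFun (funext fun θ => ?_)
  rw [hch, charFun_gaussianReal, Real.rpow_two, sq_abs]
  congr 1
  have h : (((2 * c).toNNReal : ℝ) : ℂ) = ((2 * c : ℝ) : ℂ) := by
    rw [Real.coe_toNNReal _ (by positivity)]
  rw [h]
  push_cast
  ring

lemma moments_of_charFun (hY : AEMeasurable Y Pr) (hc : 0 ≤ c)
    (hch : ∀ θ : ℝ, charFun (Pr.map Y) θ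
      = Complex.exp ((-(c * |θ| ^ (2 : ℝ)) : ℝ) : ℂ)) :
    MemLp Y 2 Pr ∧ ∫ ω, Y ω ∂Pr = 0 ∧ ∫ ω, Y ω ^ 2 ∂Pr = 2 * c := by
  have hmap := map_eq_gaussianReal_of_charFun hY hc hch
  have hmean : ∫ ω, Y ω ∂Pr = 0 := by
    have := integral_map hY (f := fun y : ℝ => y) (by fun_prop)
    rw [← this, hmap, integral_id_gaussianReal]
  refine ⟨?_, hmean, ?_⟩
  · have h1 : MemLp id 2 (Pr.map Y) := by
      rw [hmap]; exact memLp_id_gaussianReal' 2 (by norm_num)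
    exact (memLp_map_measure_iff aestronglyMeasurable_id hY).1 h1
  · have h1 := integral_map hY (f := fun y : ℝ => y ^ 2) (by fun_prop)
    have h2 : Var[fun x : ℝ => x; gaussianReal 0 (2 * c).toNNReal] = _ :=
      variance_fun_id_gaussianReal
    rw [variance_eq_integral (by fun_prop), integral_id_gaussianReal] at h2
    simp only [sub_zero] at h2
    rw [← h1, hmap, h2, Real.coe_toNNReal _ (by positivity)]

end GaussianLaw

/-! ### The generalized field -/

section GeneralizedField

variable {E 𝕏 Ω : Type*} [MeasurableSpace E] [MetricSpace 𝕏] [MeasurableSpace 𝕏]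
  [MeasurableSpace Ω] {B : ℕ → Set E} {μ : Measure E} {α β δ δ' : ℝ} {A : 𝕏 → Set E}
  {P' : Kernel ℝ (PointMeasure B)} [IsMarkovKernel P'] {lam : Measure 𝕏} [SFinite lam]
  {Pr : Measure Ω} [IsProbabilityMeasure Pr] {M : Set (ℝ × PointMeasure B) → Ω → ℝ}

namespace IsParityModel

lemma aestronglyMeasurable_integrand (h : IsParityModel μ A β P') {f : 𝕏 → ℝ}
    (hf : Measurable f) :
    AEStronglyMeasurable (integrand A lam P' f) (controlMeasure P') :=
  (h.measurable_integrand hf).aestronglyMeasurable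

lemma isStochasticIntegral_G (h : IsParityModel μ A β P') (hδ : 0 < δ) (hδ' : 0 < δ')
    (hα : 0 < α) (hα2 : α ≤ 2) (hM : IsSymmStableRandomMeasure α (controlMeasure P') M Pr)
    {f : 𝕏 → ℝ} (hf : IsTestFunction μ A lam δ δ' β f) :
    IsStochasticIntegral α (controlMeasure P') M Pr (integrand A lam P' f)
      (G A lam P' α M Pr f) :=
  isStochasticIntegral_stochasticIntegral hM hα hα2 (h.memLp_integrand hδ hδ' hf hα hα2)

/-- A linear combination of versions is a version of the integral of the combined integrand, so its
scale is the energy of that integrand. -/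
lemma charFun_sum_G (h : IsParityModel μ A β P') (hδ : 0 < δ) (hδ' : 0 < δ')
    (hα : 0 < α) (hα2 : α ≤ 2) (hM : IsSymmStableRandomMeasure α (controlMeasure P') M Pr)
    {T : Type*} {f : T → 𝕏 → ℝ} (hf : ∀ t, IsTestFunction μ A lam δ δ' β (f t)) (s : Finset T)
    (a : T → ℝ) (θ : ℝ) :
    charFun (Pr.map (fun ω => ∑ t ∈ s, a t * G A lam P' α M Pr (f t) ω)) θ
      = Complex.exp ((-((∫ p, |∑ t ∈ s, a t * integrand A lam P' (f t) p| ^ α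
          ∂(controlMeasure P')) * |θ| ^ α) : ℝ) : ℂ) := by
  have hmem : MemLp (fun p => ∑ t ∈ s, a t * integrand A lam P' (f t) p) (ENNReal.ofReal α)
      (controlMeasure P') :=
    memLp_finsetSum s fun t _ => (h.memLp_integrand hδ hδ' (hf t) hα hα2).const_mul (a t)
  have hI := IsStochasticIntegral.finset_sum hM hα hα2 s a
    (fun t => h.aestronglyMeasurable_integrand (hf t).measurable)
    (fun t => h.isStochasticIntegral_G hδ hδ' hα hα2 hM (hf t))
  rw [IsStochasticIntegral.charFun_eq hM hα hmem.1 ((memLp_iff_alphaEnergy hα hmem.1).1 hmem) hI,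
    toReal_alphaEnergy hα.le hmem.1]

lemma charFun_G (h : IsParityModel μ A β P') (hδ : 0 < δ) (hδ' : 0 < δ')
    (hα : 0 < α) (hα2 : α ≤ 2) (hM : IsSymmStableRandomMeasure α (controlMeasure P') M Pr)
    {f : 𝕏 → ℝ} (hf : IsTestFunction μ A lam δ δ' β f) (θ : ℝ) :
    charFun (Pr.map (G A lam P' α M Pr f)) θ
      = Complex.exp ((-((∫ p, |integrand A lam P' f p| ^ α ∂(controlMeasure P')) * |θ| ^ α) : ℝ)
        : ℂ) := by
  have := h.charFun_sum_G hδ hδ' hα hα2 hM (fun _ : Unit => hf) Finset.univ (fun _ => 1) θ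
  simpa using this

lemma isSymmStableFamily_G (h : IsParityModel μ A β P') (hδ : 0 < δ) (hδ' : 0 < δ')
    (hα : 0 < α) (hα2 : α ≤ 2) (hM : IsSymmStableRandomMeasure α (controlMeasure P') M Pr) :
    IsSymmStableFamily α (fun f : {f // IsTestFunction μ A lam δ δ' β f} =>
      G A lam P' α M Pr f.1) Pr := by
  have hG : ∀ f : {f // IsTestFunction μ A lam δ δ' β f},
      AEMeasurable (G A lam P' α M Pr f.1) Pr := fun f =>
    (h.isStochasticIntegral_G hδ hδ' hα hα2 hM f.2).1
  refine ⟨hG, fun I a => ⟨∫ p, |∑ t ∈ I, a t * integrand A lam P' t.1 p| ^ α ∂(controlMeasure P'),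
    integral_nonneg fun _ => by positivity, fun θ => ?_⟩⟩
  · rw [← charFun_map_eq (Finset.aemeasurable_fun_sum I fun f _ => (hG f).const_mul (a f))]
    exact h.charFun_sum_G hδ hδ' hα hα2 hM (fun f : {f // IsTestFunction μ A lam δ δ' β f} => f.2)
      I a θ

/-- A finite-dimensional law is Gaussian once all its linear images are, and each such image is a
finite linear combination with known characteristic function. -/
lemma isGaussianProcess_G (h : IsParityModel μ A β P') (hδ : 0 < δ) (hδ' : 0 < δ')
    (hM : IsSymmStableRandomMeasure 2 (controlMeasure P') M Pr) :
    IsGaussianProcess (fun f : {f // IsTestFunction μ A lam δ δ' β f} =>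
      G A lam P' 2 M Pr f.1) Pr := by
  classical
  have hG : ∀ f : {f // IsTestFunction μ A lam δ δ' β f},
      AEMeasurable (G A lam P' 2 M Pr f.1) Pr := fun f =>
    (h.isStochasticIntegral_G hδ hδ' zero_lt_two le_rfl hM f.2).1
  refine ⟨fun I => ⟨?_⟩⟩
  have hmeas : AEMeasurable (fun ω => I.restrict
      (fun f : {f // IsTestFunction μ A lam δ δ' β f} => G A lam P' 2 M Pr f.1 ω)) Pr :=
    aemeasurable_pi_lambda _ fun t => hG t.1
  refine isGaussian_of_map_eq_gaussianReal fun L => ?_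
  have hL : (L ∘ fun ω => I.restrict
      (fun f : {f // IsTestFunction μ A lam δ δ' β f} => G A lam P' 2 M Pr f.1 ω))
      = fun ω => ∑ t : I, L (Pi.single t 1) * G A lam P' 2 M Pr t.1.1 ω := by
    ext ω
    simp only [Function.comp_apply]
    rw [← ContinuousLinearMap.coe_coe, LinearMap.pi_apply_eq_sum_univ]
    refine Finset.sum_congr rfl fun t _ => ?_
    rw [smul_eq_mul, mul_comm]
    congr 2
    ext j
    simp [Pi.single_apply, eq_comm]
  rw [AEMeasurable.map_map_of_aemeasurable L.continuous.aemeasurable hmeas, hL]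
  exact ⟨0, _, map_eq_gaussianReal_of_charFun
    (Finset.aemeasurable_fun_sum _ fun t _ => (hG t.1).const_mul _)
    (integral_nonneg fun _ => by positivity)
    (h.charFun_sum_G hδ hδ' zero_lt_two le_rfl hM (fun t : I => t.1.2) Finset.univ _)⟩

lemma covariance_G (h : IsParityModel μ A β P') (hδ : 0 < δ) (hδ' : 0 < δ')
    (hM : IsSymmStableRandomMeasure 2 (controlMeasure P') M Pr) {f g : 𝕏 → ℝ}
    (hf : IsTestFunction μ A lam δ δ' β f) (hg : IsTestFunction μ A lam δ δ' β g) :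
    covariance (G A lam P' 2 M Pr f) (G A lam P' 2 M Pr g) Pr
      = 2 * ∫ p, integrand A lam P' f p * integrand A lam P' g p ∂(controlMeasure P') := by
  have hmom : ∀ {f : 𝕏 → ℝ}, IsTestFunction μ A lam δ δ' β f → _ := fun {f} hf =>
    moments_of_charFun (Pr := Pr) (h.isStochasticIntegral_G hδ hδ' zero_lt_two le_rfl hM hf).1
      (integral_nonneg fun _ => by positivity) (h.charFun_G hδ hδ' zero_lt_two le_rfl hM hf)
  obtain ⟨f1, f2, f3⟩ := hmom hf
  obtain ⟨g1, g2, g3⟩ := hmom hg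
  -- The two-point family indexed by `Bool` yields the law of G(f) + G(g). Polarizing the second
  -- moments of G(f), G(g) and their sum leaves the mixed term.
  have hsum := h.charFun_sum_G hδ hδ' zero_lt_two le_rfl hM
    (f := fun b : Bool => if b then f else g) (lam := lam) (δ := δ) (δ' := δ')
    (fun b => by cases b <;> simp [hf, hg])
    Finset.univ (fun _ => 1)
  simp only [Fintype.sum_bool, if_true, Bool.false_eq_true, if_false, one_mul] at hsum
  obtain ⟨-, -, s3⟩ := moments_of_charFun (f1.1.aemeasurable.add g1.1.aemeasurable)
    (integral_nonneg fun _ => by positivity) hsum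
  simp only [Real.rpow_two, sq_abs] at f3 g3 s3
  have hI : ∀ {f : 𝕏 → ℝ}, IsTestFunction μ A lam δ δ' β f →
      MemLp (integrand A lam P' f) 2 (controlMeasure P') := fun hf => by
    simpa using h.memLp_integrand hδ hδ' hf zero_lt_two le_rfl
  have e1 := integral_add_sq f1 g1
  have e2 := integral_add_sq (hI hf) (hI hg)
  rw [f3, g3] at e1
  have e3 : ∫ ω, (G A lam P' 2 M Pr f ω + G A lam P' 2 M Pr g ω) ^ 2 ∂Pr
      = 2 * ∫ p, (integrand A lam P' f p + integrand A lam P' g p) ^ 2 ∂(controlMeasure P') := s3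
  rw [covariance_eq_sub f1 g1, f2, g2]
  simp only [Pi.mul_apply]
  linarith

end IsParityModel

end GeneralizedField

end LogCorr

end

theorem theorem3p1 {E 𝕏 : Type*} [MeasurableSpace E]
    [MetricSpace 𝕏] [MeasurableSpace 𝕏] [BorelSpace 𝕏]
    (μ : Measure E) (B : ℕ → Set E) (hB : LogCorr.IsLocalizing μ B)
    (A : 𝕏 → Set E) (hA : MeasurableSet {p : 𝕏 × E | p.2 ∈ A p.1})
    (hAfin : ∀ x, μ (A x) < ∞)
    (hd : ∀ x y, dist x y = μ.real (symmDiff (A x) (A y)))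
    (lam : Measure 𝕏) [SigmaFinite lam]
    (β : ℝ) (hβ : 0 < β) (hβ1 : β ≤ 1)
    (P' : Kernel ℝ (LogCorr.PointMeasure B)) [IsMarkovKernel P']
    (hP' : ∀ r : ℝ, 0 < r → LogCorr.IsStablePoissonLaw μ β r (P' r)) :
    -- each `Γ_r` is nonnegative and positive definite
    (∀ r : ℝ, 0 < r → (∀ x y, 0 ≤ LogCorr.gammaR A P' r x y) ∧
      ∀ (n : ℕ) (x : Fin n → 𝕏),
        (Matrix.of fun i j => LogCorr.gammaR A P' r (x i) (x j)).PosSemidef) ∧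
    -- the decomposition of `Γ`, off the diagonal
    (∀ x y, x ≠ y →
      IntegrableOn (fun r => LogCorr.gammaR A P' r x y / r) (Ioi 0) ∧
      LogCorr.Gam μ A β x y = 4 * ∫ r in Ioi (0 : ℝ), LogCorr.gammaR A P' r x y / r) ∧
    -- on the diagonal both sides are infinite
    (∀ x, μ (A x) ≠ 0 →
      ∫⁻ r in Ioi (0 : ℝ), ENNReal.ofReal (LogCorr.gammaR A P' r x x / r) = ∞) ∧
    -- the stochastic integrals
    ∀ (α : ℝ), 0 < α → α ≤ 2 → ∀ (δ δ' : ℝ), 0 < δ → 0 < δ' →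
    ∀ {Ω : Type*} [MeasurableSpace Ω] (Pr : Measure Ω) [IsProbabilityMeasure Pr]
      (M : Set (ℝ × LogCorr.PointMeasure B) → Ω → ℝ),
      LogCorr.IsSymmStableRandomMeasure α (LogCorr.controlMeasure P') M Pr →
      -- the integrals are well defined
      (∀ f, LogCorr.IsTestFunction μ A lam δ δ' β f →
        (∀ r : ℝ, 0 < r → ∀ m : LogCorr.PointMeasure B,
          Integrable (fun x => LogCorr.centredOdd A P' r m x * f x) lam) ∧
        MemLp (LogCorr.integrand A lam P' f) (ENNReal.ofReal α) (LogCorr.controlMeasure P') ∧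
        LogCorr.IsStochasticIntegral α (LogCorr.controlMeasure P') M Pr
          (LogCorr.integrand A lam P' f) (LogCorr.G A lam P' α M Pr f) ∧
        ∀ I, LogCorr.IsStochasticIntegral α (LogCorr.controlMeasure P') M Pr
          (LogCorr.integrand A lam P' f) I → I =ᵐ[Pr] LogCorr.G A lam P' α M Pr f) ∧
      -- they form a symmetric stable family
      LogCorr.IsSymmStableFamily α
        (fun f : {f // LogCorr.IsTestFunction μ A lam δ δ' β f} =>
          LogCorr.G A lam P' α M Pr f.1) Pr ∧
      -- the characteristic function
      (∀ f, LogCorr.IsTestFunction μ A lam δ δ' β f →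
        (∀ r : ℝ, 0 < r →
          Integrable (fun m => |LogCorr.integrand A lam P' f (r, m)| ^ α) (P' r)) ∧
        IntegrableOn
          (fun r => (∫ m, |LogCorr.integrand A lam P' f (r, m)| ^ α ∂(P' r)) / r) (Ioi 0) ∧
        ∫ ω, Complex.exp (Complex.I * (LogCorr.G A lam P' α M Pr f ω : ℂ)) ∂Pr
          = Complex.exp ((-2 * ∫ r in Ioi (0 : ℝ),
              (∫ m, |LogCorr.integrand A lam P' f (r, m)| ^ α ∂(P' r)) / r : ℝ) : ℂ)) ∧
      -- the Gaussian case
      (α = 2 →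
        IsGaussianProcess
          (fun f : {f // LogCorr.IsTestFunction μ A lam δ δ' β f} =>
            LogCorr.G A lam P' α M Pr f.1) Pr ∧
        (∀ f, LogCorr.IsTestFunction μ A lam δ δ' β f →
          ∫ ω, LogCorr.G A lam P' α M Pr f ω ∂Pr = 0) ∧
        ∀ f g, LogCorr.IsTestFunction μ A lam δ δ' β f →
          LogCorr.IsTestFunction μ A lam δ δ' β g →
          -- the diagonal, where `Γ` is infinite, does not contribute
          (∀ᵐ p ∂(lam.prod lam), p.1 = p.2 → f p.1 * g p.2 = 0) ∧
          Integrable (fun p : 𝕏 × 𝕏 => f p.1 * g p.2 * LogCorr.Gam μ A β p.1 p.2)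
            (lam.prod lam) ∧
          covariance (LogCorr.G A lam P' α M Pr f) (LogCorr.G A lam P' α M Pr g) Pr
            = ∫ x, ∫ y, f x * g y * LogCorr.Gam μ A β x y ∂lam ∂lam) := by
  have h : LogCorr.IsParityModel μ A β P' := ⟨hB, hA, hAfin, hd, hβ, hβ1, hP'⟩
  refine ⟨fun r hr => ⟨LogCorr.gammaR_nonneg (hP' r hr) hr hβ hβ1 h.measurableSet hAfin,
    LogCorr.posSemidef_gammaR h.measurableSet⟩,
    fun x y hxy => LogCorr.gammaR_decomposition hP' hβ hβ1 h.measurableSet hAfin hd hxy,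
    fun x hx => LogCorr.lintegral_gammaR_self_div hP' hβ h.measurableSet hAfin hx, ?_⟩
  intro α hα hα2 δ δ' hδ hδ' Ω _ Pr _ M hM
  refine ⟨fun f hf => ⟨fun r _ m => h.integrable_centredOdd_mul hf.integrable r m,
    h.memLp_integrand hδ hδ' hf hα hα2, h.isStochasticIntegral_G hδ hδ' hα hα2 hM hf,
    fun I hI => hI.ae_unique hM hα hα2 (h.aestronglyMeasurable_integrand hf.measurable)
      (h.isStochasticIntegral_G hδ hδ' hα hα2 hM hf)⟩,
    h.isSymmStableFamily_G hδ hδ' hα hα2 hM, fun f hf =>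
    ⟨fun r _ => h.integrable_integrand_rpow hf.measurable hf.integrable hα.le r,
      h.integrableOn_integrand_rpow_div hδ hδ' hf hα hα2, ?_⟩, ?_⟩
  -- The characteristic function is taken at θ = 1; the factor 2 comes from the control density 2/r.
  · have h1 := LogCorr.charFun_map_eq (h.isStochasticIntegral_G hδ hδ' hα hα2 hM hf).1 1
    rw [h.charFun_G hδ hδ' hα hα2 hM hf,
      h.integral_integrand_rpow_controlMeasure hδ hδ' hf hα hα2] at h1
    simp only [one_mul, abs_one, Real.one_rpow, mul_one] at h1
    rw [← h1, neg_mul]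
  · rintro rfl
    refine ⟨h.isGaussianProcess_G hδ hδ' hM, fun f hf => ?_, fun f g hf hg =>
      ⟨h.ae_diagonal hδ' g hf, h.integrable_mul_gam hδ hδ' hf hg, ?_⟩⟩
    · exact (LogCorr.moments_of_charFun (h.isStochasticIntegral_G hδ hδ' hα hα2 hM hf).1
        (integral_nonneg fun _ => by positivity) (h.charFun_G hδ hδ' hα hα2 hM hf)).2.1
    · rw [h.covariance_G hδ hδ' hM hf hg, h.integral_mul_gam (P' := P') hδ hδ' hf hg]
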